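/- **Setting.** Let $P$ be the transition matrix of a Markov chain on a finite state space $\mathcal S$ (a Markov decision process with a fixed policy), with rewards $|\mathcal R(s,s')|\le B$, discount factor $0<\gamma<1$, and feature vectors $\phi(s)\in\mathbb R^d$, $\|\phi(s)\|\le 1$, such that the feature matrix $\Phi$ (with rows $\phi(s)^\top$) has full column rank. Assume that $\pi(s')=\lim_{t\to\infty}P^t(s,s')>0$ for all $s,s'$ and that $\sup_s\sum_{s'}|P^t(s,s')-\pi(s')|\le\bar\kappa\rho^t$ for all $t\ge 0$, where $0\le\rho<1$. Let $\omega$ be the smallest eigenvalue of $\Phi^\top\mathrm{Diag}(\pi)\Phi$, let $(\mathcal T V)(s)=\sum_{s'}P(s,s')\,(\mathcal R(s,s')+\gamma V(s'))$, and let $\theta^*$ be the solution of the projected Bellman equation $\Phi\theta^*=\mathrm{Proj}_\Phi(\mathcal T\Phi\theta^*)$, where $\mathrm{Proj}_\Phi$ is the projection onto the column space of $\Phi$ in the $\pi$-weighted norm $\|V\|_\pi^2=\sum_s\pi(s)V(s)^2$. **Algorithm (projected AdaTD(0)).** Let $(s_k)$ be a Markov chain with transition matrix $P$ and any initial law. Start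 from $\theta^1=\theta^0$ with $\|\theta^0\|\le R$, $m^0=0$, $v^0=0$, and for $k\ge1$ put $$g^k=\big(\mathcal R(s_k,s_{k+1})+\gamma\phi(s_{k+1})^\top\theta^k-\phi(s_k)^\top\theta^k\big)\phi(s_k),\quad m^k=\beta m^{k-1}+(1-\beta)g^k,\quad v^k=v^{k-1}+\|g^k\|^2,$$ $$\theta^{k+1}=\mathrm{Proj}_R\big(\theta^k+\eta\, m^k/\sqrt{v^k+\delta}\big),$$ where $\mathrm{Proj}_R$ is the projection onto the Euclidean ball of radius $R$ around $0$. **Theorem 2.** Let $\eta>0$, $\delta>0$, $0\le\beta<1$, $R>0$ and $R\ge 2B/\big(\sqrt\omega\,(1-\gamma)^{3/2}\big)$. Suppose that almost surely $v^k\le c\,k^\nu$ for all $k\ge1$, where $c>0$ and $0<\nu\le1$. Then for every $0<\epsilon\le\frac12$ there is a $K\ge1$ with $\min_{1\le k\le K}\mathbb E\|\theta^k-\theta^*\|^2\le\epsilon$ and $$K=\tilde O(b),\qquad b=\left(\frac1\epsilon\,\max\Big\{1,\frac{\ln(1/\epsilon)}{\ln(1/\rho)}\Big\}^2\right)^{\frac1{1-\nu/2}},$$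 where $\ln(1/\rho)=\infty$ if $\rho=0$. That is, $K\le C\,b\,(\ln b)^p$ with $C$ and $p$ depending only on $\gamma,B,R,\omega,\bar\kappa,\beta,\eta,\delta,c,\nu$ (not on $\epsilon$, $\rho$, $\mathcal S$, $d$, the initial data or the chain). In particular, for $\epsilon\le\min\{\rho,\frac12\}$ the number of iterations needed is $$\tilde O\!\left(\Big(\ln\frac1\epsilon\Big)^{\frac{2}{1-\nu/2}}\Big/\Big[\epsilon^{\frac1{1-\nu/2}}\Big(\ln\frac1\rho\Big)^{\frac{2}{1-\nu/2}}\Big]\right).$$ -/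

import Mathlib

open MeasureTheory Filter Topology

noncomputable section

namespace AdaTD

/-- A Markov reward process on a finite state space (a Markov decision process with the policy
fixed), together with a `d`-dimensional feature map. -/
structure Model (S : Type*) [Fintype S] (d : ℕ) where
  /-- transition matrix, `P s s'` is the probability of moving from `s` to `s'` -/
  P : Matrix S S ℝ
  /-- reward of the transition from `s` to `s'` -/
  reward : S → S → ℝ
  /-- feature vectors, with the Euclidean norm -/
  φ : S → EuclideanSpace ℝ (Fin d)
  P_nonneg : ∀ s s', 0 ≤ P s s'
  P_sum : ∀ s, ∑ s', P s s' = 1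

variable {S : Type*} [Fintype S] {d : ℕ}

namespace Model

/-- The linear value function `V_θ(s) = φ(s)ᵀ θ`. -/
def value (M : Model S d) (θ : EuclideanSpace ℝ (Fin d)) (s : S) : ℝ :=
  inner ℝ (M.φ s) θ

/-- The feature matrix `Φ`, whose rows are the feature vectors. -/
def featureMatrix (M : Model S d) : Matrix S (Fin d) ℝ :=
  Matrix.of fun s i => M.φ s i

/-- The Bellman operator
`(T V)(s) = ∑ s', P(s' | s) R(s, s') + γ ∑ s', P(s' | s) V(s')`. -/
def bellman (M : Model S d) (γ : ℝ) (V : S → ℝ) (s : S) : ℝ :=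
  (∑ s', M.P s s' * M.reward s s') + γ * ∑ s', M.P s s' * V s'

/-- Uniform geometric ergodicity: every row of `P ^ t` converges to the everywhere positive vector
`π`, and the distance is at most `κ * ρ ^ t`. -/
structure Mixing [DecidableEq S] (M : Model S d) (π : S → ℝ) (κ ρ : ℝ) : Prop where
  pos : ∀ s, 0 < π s
  tendsto : ∀ s s', Tendsto (fun t : ℕ => (M.P ^ t) s s') atTop (𝓝 (π s'))
  bound : ∀ (t : ℕ) (s : S), ∑ s', |(M.P ^ t) s s' - π s'| ≤ κ * ρ ^ t

/-- `ω` is the smallest eigenvalue of `Φᵀ Diag(π) Φ`. -/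
def IsMinEigenvalue [DecidableEq S] (M : Model S d) (π : S → ℝ) (ω : ℝ) : Prop :=
  IsLeast {x : ℝ | Module.End.HasEigenvalue
    (Matrix.toLin' (M.featureMatrix.transpose * Matrix.diagonal π * M.featureMatrix)) x} ω

/-- The squared `π`-weighted norm on functions of the state. -/
def weightedSq (π : S → ℝ) (V : S → ℝ) : ℝ := ∑ s, π s * V s ^ 2

/-- `θ` solves the projected Bellman equation `Φ θ = Proj_Φ (T (Φ θ))`: the vector `Φ θ` is the
point of the column space of `Φ` that is closest to `T (Φ θ)` in the `π`-weighted norm. -/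
def SolvesProjectedBellman (M : Model S d) (γ : ℝ) (π : S → ℝ)
    (θ : EuclideanSpace ℝ (Fin d)) : Prop :=
  ∀ θ' : EuclideanSpace ℝ (Fin d),
    weightedSq π (fun s => M.bellman γ (M.value θ) s - M.value θ s) ≤
      weightedSq π (fun s => M.bellman γ (M.value θ) s - M.value θ' s)

/-- The stochastic semi-gradient `(R(s, s') + γ V_θ(s') - V_θ(s)) φ(s)`. -/
def semiGrad (M : Model S d) (γ : ℝ) (θ : EuclideanSpace ℝ (Fin d)) (s s' : S) :
    EuclideanSpace ℝ (Fin d) :=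
  (M.reward s s' + γ * M.value θ s' - M.value θ s) • M.φ s

end Model

/-- Euclidean projection onto the closed ball of radius `R` around the origin. -/
def projBall (R : ℝ) (y : EuclideanSpace ℝ (Fin d)) : EuclideanSpace ℝ (Fin d) :=
  if ‖y‖ ≤ R then y else (R / ‖y‖) • y

/-- The memory of the algorithm: current parameter, momentum, accumulated squared norms. -/
structure State (d : ℕ) where
  θ : EuclideanSpace ℝ (Fin d)
  m : EuclideanSpace ℝ (Fin d)
  v : ℝ

/-- One iteration of projected AdaTD(0) on the transition `s → s'`. -/
def step (M : Model S d) (γ R β η δ : ℝ) (x : State d) (s s' : S) : State d :=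
  let g := M.semiGrad γ x.θ s s'
  let m := β • x.m + (1 - β) • g
  let v := x.v + ‖g‖ ^ 2
  { θ := projBall R (x.θ + (η / Real.sqrt (v + δ)) • m), m := m, v := v }

/-- The memory `(θ^{k+1}, m^k, v^k)` after `k` iterations along the state trajectory `x`; the
`k`-th iteration, `k = 1, 2, …`, uses the transition `x k → x (k + 1)`. -/
def run (M : Model S d) (γ R β η δ : ℝ) (θ₀ : EuclideanSpace ℝ (Fin d)) (x : ℕ → S) :
    ℕ → State d
  | 0 => { θ := θ₀, m := 0, v := 0 }
  | k + 1 => step M γ R β η δ (run M γ R β η δ θ₀ x k) (x (k + 1)) (x (k + 2))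

/-- The iterate `θ^k` (with `θ^1 = θ^0 = θ₀`). -/
def iterate (M : Model S d) (γ R β η δ : ℝ) (θ₀ : EuclideanSpace ℝ (Fin d)) (x : ℕ → S) (k : ℕ) :
    EuclideanSpace ℝ (Fin d) :=
  (run M γ R β η δ θ₀ x (k - 1)).θ

/-- The accumulated squared semi-gradient norms `v^k = ∑_{i = 1}^k ‖g^i‖²`. -/
def accum (M : Model S d) (γ R β η δ : ℝ) (θ₀ : EuclideanSpace ℝ (Fin d)) (x : ℕ → S) (k : ℕ) :
    ℝ :=
  (run M γ R β η δ θ₀ x k).v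

/-- `X 0, X 1, …` is a Markov chain with transition matrix `P` and arbitrary initial law. -/
structure IsMarkovChain [MeasurableSpace S] {Ω : Type*} [MeasurableSpace Ω]
    (P : Matrix S S ℝ) (X : ℕ → Ω → S) (μ : Measure Ω) : Prop where
  measurable : ∀ k, Measurable (X k)
  markov : ∀ (n : ℕ) (x : ℕ → S),
    μ.real {w | ∀ i ≤ n + 1, X i w = x i} =
      μ.real {w | ∀ i ≤ n, X i w = x i} * P (x n) (x (n + 1))

/-- The complexity `(max {1, ln(1/ε) / ln(1/ρ)}² / ε) ^ (1 / (1 - ν/2))`. For `ρ = 0`, where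
`ln(1/ρ) = ∞`, the quotient of logarithms evaluates to `0`, as it should. -/
def rate (ν ρ ε : ℝ) : ℝ :=
  (max 1 (Real.log (1 / ε) / Real.log (1 / ρ)) ^ 2 / ε) ^ (1 / (1 - ν / 2))

end AdaTD

end

/-! Bound the step-weighted error `∑ a (n+1) * ‖θ n - θs‖²` in expectation from above and below, and
choose `K` so that the bounds clash if every mean squared error up to `K` exceeds `ε`. Here `a n = η
/ √(v n + δ)`, and `θ n` in `run` is the iterate with number `n + 1`.

Upper bound. The mean semi-gradient vanishes at `θs` and points towards it with strength `(1 - γ) *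
ω` (`Stationary.inner_meanGrad_ge`, `IsMinEigenvalue.mul_norm_sq_le`). A potential argument for
momentum (`momentum_regret_le`) bounds the weighted correlation of the semi-gradients with `θs - θ
n` by a constant plus `∑ a² ‖m‖²`, which is only logarithmic in `K` because `v` accumulates the very
norms being summed (`sum_div_le_log`). Markovian noise remains. The step `a (n+1)` depends on the
current transition, so both weight and parameter are replaced by their values `τ` steps earlier. The
weights cost a telescoping `O(τ)`. The parameters cost `O(τ² log K)` after half of the drift has
absorbed one term. The delayed noise has mean `O(ρ ^ τ)` by the Markov property and mixing.
Altogether the bound is `O(τ² (1 + log K) + K ρ ^ τ)` (`sum_integral_error_le`).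

Lower bound. The growth assumption on `v` gives `a n ≥ const * K ^ (-ν/2)` for `1 ≤ n ≤ K`, so the
sum would be at least `const * ε * K ^ (1 - ν/2)`. `exists_horizon` picks `K` and `τ ≈ log K` times
the mixing factor to contradict this. -/

namespace AdaTD

/-! ### Projection onto the ball -/

section Projection

variable {d : ℕ}

theorem norm_projBall_le {R : ℝ} (hR : 0 ≤ R) (y : EuclideanSpace ℝ (Fin d)) :
    ‖projBall R y‖ ≤ R := by
  unfold projBall
  split_ifs with h
  · exact h
  · have hy : 0 < ‖y‖ := lt_of_le_of_lt hR (not_le.mp h)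
    rw [norm_smul, Real.norm_of_nonneg (div_nonneg hR hy.le), div_mul_cancel₀ _ hy.ne']

theorem norm_projBall_sub_le {R : ℝ} (hR : 0 ≤ R) (y : EuclideanSpace ℝ (Fin d))
    {z : EuclideanSpace ℝ (Fin d)} (hz : ‖z‖ ≤ R) : ‖projBall R y - z‖ ≤ ‖y - z‖ := by
  unfold projBall
  split_ifs with h
  · exact le_rfl
  · push Not at h
    have hy : 0 < ‖y‖ := lt_of_le_of_lt hR h
    set r := R / ‖y‖ with hr
    have hr1 : r ≤ 1 := (div_le_one hy).2 h.le
    have hry : r * ‖y‖ = R := div_mul_cancel₀ _ hy.ne'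
    have hin : inner ℝ y z ≤ ‖y‖ * R :=
      (real_inner_le_norm y z).trans (mul_le_mul_of_nonneg_left hz hy.le)
    -- Expanding along `y - z = (r • y - z) + (1 - r) • y`; the cross term is nonnegative because
    -- `⟪y, z⟫ ≤ ‖y‖ * R`.
    have key : ‖y - z‖ ^ 2 = ‖r • y - z‖ ^ 2
        + 2 * ((1 - r) * (r * ‖y‖ * ‖y‖ - inner ℝ y z)) + ((1 - r) * ‖y‖) ^ 2 := by
      rw [norm_sub_sq_real, norm_sub_sq_real, norm_smul, inner_smul_left, mul_pow,
        Real.norm_eq_abs, sq_abs]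
      simp only [conj_trivial]
      ring
    rw [hry] at key
    have h2 : 0 ≤ (1 - r) * (R * ‖y‖ - inner ℝ y z) :=
      mul_nonneg (by linarith) (by linarith)
    refine le_of_sq_le_sq ?_ (norm_nonneg _)
    nlinarith [sq_nonneg ((1 - r) * ‖y‖)]

end Projection

/-! ### Telescoping, delayed and logarithmic sums -/

section Sums

theorem sum_sub_shift_le {F : ℕ → ℝ} (hF : Antitone F) (h0 : ∀ n, 0 ≤ F n) (m K : ℕ) :
    ∑ n ∈ Finset.range K, (F n - F (n + m)) ≤ m * F 0 := by
  have e1 := Finset.sum_range_add F K m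
  have e2 := Finset.sum_range_add F m K
  rw [add_comm m K] at e2
  have e3 : ∑ n ∈ Finset.range K, F (n + m) = ∑ n ∈ Finset.range K, F (m + n) :=
    Finset.sum_congr rfl fun n _ => by rw [add_comm]
  have h1 : ∑ n ∈ Finset.range m, F n ≤ m * F 0 := by
    simpa using Finset.sum_le_card_nsmul (Finset.range m) F (F 0) fun n _ => hF (Nat.zero_le n)
  have h2 : 0 ≤ ∑ n ∈ Finset.range m, F (K + n) := Finset.sum_nonneg fun n _ => h0 _
  rw [Finset.sum_sub_distrib, e3]
  linarith

/-- Telescoping with stride `τ + 1`: only the first `τ + 1` terms survive. This pays for replacing a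
step size by its delayed value. -/
theorem sum_delay_sub_le {f : ℕ → ℝ} (hf : Antitone f) (h0 : ∀ n, 0 ≤ f n) (τ K : ℕ) :
    ∑ n ∈ Finset.range K, (f (n - τ) - f (n + 1)) ≤ (τ + 1) * f 0 := by
  have h := sum_sub_shift_le (F := fun n => f (n - τ))
    (fun i j hij => hf (Nat.sub_le_sub_right hij τ)) (fun n => h0 _) (τ + 1) K
  have e : ∀ n, n + (τ + 1) - τ = n + 1 := fun n => by omega
  simpa [e] using h

/-- Each index `j` lies in at most `τ` of the windows `[n - τ, n)`. -/
theorem sum_window_le {f : ℕ → ℝ} (h0 : ∀ n, 0 ≤ f n) (τ K : ℕ) :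
    ∑ n ∈ Finset.range K, ∑ j ∈ Finset.Ico (n - τ) n, f j ≤ τ * ∑ j ∈ Finset.range K, f j := by
  have h1 : ∀ n ∈ Finset.range K, ∑ j ∈ Finset.Ico (n - τ) n, f j
      = ∑ j ∈ Finset.range K, if j ∈ Finset.Ico (n - τ) n then f j else 0 := by
    intro n hn
    rw [← Finset.sum_filter]
    refine Finset.sum_congr ?_ fun _ _ => rfl
    ext j
    simp only [Finset.mem_range, Finset.mem_filter, Finset.mem_Ico] at *
    omega
  rw [Finset.sum_congr rfl h1, Finset.sum_comm, Finset.mul_sum]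
  refine Finset.sum_le_sum fun j _ => ?_
  rw [← Finset.sum_filter, Finset.sum_const, nsmul_eq_mul]
  refine mul_le_mul_of_nonneg_right ?_ (h0 j)
  have hsub : (Finset.range K).filter (fun n => j ∈ Finset.Ico (n - τ) n)
      ⊆ Finset.Ioc j (j + τ) := by
    intro n
    simp only [Finset.mem_range, Finset.mem_filter, Finset.mem_Ico, Finset.mem_Ioc]
    omega
  have := Finset.card_le_card hsub
  rw [Nat.card_Ioc] at this
  exact_mod_cast this.trans (by omega)

theorem norm_sub_delay_sq_le {E : Type*} [NormedAddCommGroup E] (x : ℕ → E) (y : ℕ → ℝ)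
    (h : ∀ n, ‖x (n + 1) - x n‖ ^ 2 ≤ y n) (τ n : ℕ) :
    ‖x (n - τ) - x n‖ ^ 2 ≤ τ * ∑ j ∈ Finset.Ico (n - τ) n, y j := by
  rw [norm_sub_rev, ← Finset.sum_Ico_sub x (Nat.sub_le n τ)]
  have h1 : ‖∑ j ∈ Finset.Ico (n - τ) n, (x (j + 1) - x j)‖ ^ 2
      ≤ (∑ j ∈ Finset.Ico (n - τ) n, ‖x (j + 1) - x j‖) ^ 2 :=
    pow_le_pow_left₀ (norm_nonneg _) (norm_sum_le _ _) 2
  have h2 := sq_sum_le_card_mul_sum_sq (s := Finset.Ico (n - τ) n)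
    (f := fun j => ‖x (j + 1) - x j‖)
  refine h1.trans (h2.trans ?_)
  have hy : ∀ j, 0 ≤ y j := fun j => (sq_nonneg _).trans (h j)
  refine mul_le_mul ?_ (Finset.sum_le_sum fun j _ => h j)
    (Finset.sum_nonneg fun _ _ => sq_nonneg _) (Nat.cast_nonneg _)
  rw [Nat.card_Ico]
  exact_mod_cast (by omega : n - (n - τ) ≤ τ)

/-- The AdaGrad estimate: `1 - u ≤ -log u` with `u = (v n + δ) / (v (n + 1) + δ)` makes the sum
telescope. -/
theorem sum_div_le_log {v : ℕ → ℝ} {δ : ℝ} (hδ : 0 < δ) (hv0 : v 0 = 0) (hv : Monotone v)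
    (K : ℕ) :
    ∑ n ∈ Finset.range K, (v (n + 1) - v n) / (v (n + 1) + δ) ≤ Real.log (1 + v K / δ) := by
  have hpos : ∀ n, 0 < v n + δ := fun n => by
    have := hv (Nat.zero_le n)
    linarith
  have step : ∀ n, (v (n + 1) - v n) / (v (n + 1) + δ)
      ≤ Real.log (v (n + 1) + δ) - Real.log (v n + δ) := fun n => by
    have h := Real.log_le_sub_one_of_pos (div_pos (hpos n) (hpos (n + 1)))
    rw [Real.log_div (hpos n).ne' (hpos (n + 1)).ne'] at h
    have e : (v (n + 1) - v n) / (v (n + 1) + δ) = 1 - (v n + δ) / (v (n + 1) + δ) := by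
      have := (hpos (n + 1)).ne'
      field_simp
      ring
    linarith
  refine (Finset.sum_le_sum fun n _ => step n).trans (le_of_eq ?_)
  rw [Finset.sum_range_sub (fun n => Real.log (v n + δ)), hv0, zero_add,
    ← Real.log_div (hpos K).ne' hδ.ne']
  congr 1
  field_simp
  ring

/-- Sums of an exponential average are bounded by sums of the averaged sequence. -/
theorem sum_le_of_exp_average {y z : ℕ → ℝ} {β : ℝ} (hβ₀ : 0 ≤ β) (hβ₁ : β < 1)
    (hy : ∀ n, 0 ≤ y n) (hy0 : y 0 = 0)
    (h : ∀ n, y (n + 1) ≤ β * y n + (1 - β) * z n) (K : ℕ) :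
    ∑ n ∈ Finset.range K, y (n + 1) ≤ ∑ n ∈ Finset.range K, z n := by
  have h1 : (1 - β) * ∑ n ∈ Finset.range K, y (n + 1) + β * (y K - y 0)
      ≤ (1 - β) * ∑ n ∈ Finset.range K, z n := by
    rw [← Finset.sum_range_sub y, Finset.mul_sum, Finset.mul_sum, Finset.mul_sum,
      ← Finset.sum_add_distrib]
    exact Finset.sum_le_sum fun n _ => by linarith [h n]
  have h2 : 0 ≤ β * (y K - y 0) := mul_nonneg hβ₀ (by rw [hy0]; linarith [hy K])
  exact le_of_mul_le_mul_left (by linarith) (by linarith : 0 < 1 - β)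

end Sums

/-! ### Stationary means, the mean semi-gradient and its drift towards the solution -/

namespace Model

variable {S : Type*} [Fintype S] {d : ℕ} {M : Model S d} {π : S → ℝ}

/-- `π` is a stationary probability distribution of the chain. -/
structure Stationary (M : Model S d) (π : S → ℝ) : Prop where
  nonneg : ∀ s, 0 ≤ π s
  sum : ∑ s, π s = 1
  inv : ∀ s', ∑ s, π s * M.P s s' = π s'

theorem sum_pow [DecidableEq S] (M : Model S d) (t : ℕ) (s : S) :
    ∑ s', (M.P ^ t) s s' = 1 := by
  induction t with
  | zero => simp [Matrix.one_apply]
  | succ t ih =>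
    simp only [pow_succ, Matrix.mul_apply]
    rw [Finset.sum_comm]
    simp only [← Finset.mul_sum, M.P_sum, mul_one, ih]

theorem Mixing.stationary [DecidableEq S] [Nonempty S] {κ ρ : ℝ} (h : M.Mixing π κ ρ) :
    M.Stationary π where
  nonneg s := (h.pos s).le
  sum := by
    obtain ⟨s₀⟩ := ‹Nonempty S›
    refine tendsto_nhds_unique (tendsto_finsetSum Finset.univ fun s' _ => h.tendsto s₀ s') ?_
    simp only [M.sum_pow]
    exact tendsto_const_nhds
  inv s' := by
    obtain ⟨s₀⟩ := ‹Nonempty S›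
    refine tendsto_nhds_unique (tendsto_finsetSum Finset.univ fun s _ =>
      (h.tendsto s₀ s).mul_const (M.P s s')) ?_
    have := (h.tendsto s₀ s').comp (tendsto_add_atTop_nat 1)
    refine this.congr fun t => ?_
    simp only [Function.comp_apply, pow_succ, Matrix.mul_apply]

theorem Mixing.const_nonneg [DecidableEq S] [Nonempty S] {κ ρ : ℝ} (h : M.Mixing π κ ρ) :
    0 ≤ κ := by
  obtain ⟨s₀⟩ := ‹Nonempty S›
  have := h.bound 0 s₀
  rw [pow_zero, pow_zero, mul_one] at this
  exact (Finset.sum_nonneg fun _ _ => abs_nonneg _).trans this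

/-- Stationary expectation of a function of a transition. -/
noncomputable def mean (M : Model S d) (π : S → ℝ) (f : S → S → ℝ) : ℝ :=
  ∑ s, ∑ s', π s * M.P s s' * f s s'

theorem mean_add (f g : S → S → ℝ) :
    M.mean π (fun s s' => f s s' + g s s') = M.mean π f + M.mean π g := by
  simp only [mean, mul_add, Finset.sum_add_distrib]

theorem mean_sub (f g : S → S → ℝ) :
    M.mean π (fun s s' => f s s' - g s s') = M.mean π f - M.mean π g := by
  simp only [mean, mul_sub, Finset.sum_sub_distrib]

theorem mean_mul (a : ℝ) (f : S → S → ℝ) :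
    M.mean π (fun s s' => a * f s s') = a * M.mean π f := by
  simp only [mean, Finset.mul_sum]
  exact Finset.sum_congr rfl fun _ _ => Finset.sum_congr rfl fun _ _ => by ring

theorem Stationary.mean_mono (h : M.Stationary π) {f g : S → S → ℝ}
    (hfg : ∀ s s', f s s' ≤ g s s') : M.mean π f ≤ M.mean π g :=
  Finset.sum_le_sum fun s _ => Finset.sum_le_sum fun s' _ =>
    mul_le_mul_of_nonneg_left (hfg s s') (mul_nonneg (h.nonneg s) (M.P_nonneg s s'))

theorem mean_fst (f : S → ℝ) : M.mean π (fun s _ => f s) = ∑ s, π s * f s := by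
  refine Finset.sum_congr rfl fun s _ => ?_
  rw [← Finset.sum_mul, ← Finset.mul_sum, M.P_sum, mul_one]

theorem Stationary.mean_snd (h : M.Stationary π) (f : S → ℝ) :
    M.mean π (fun _ s' => f s') = ∑ s, π s * f s := by
  unfold mean
  rw [Finset.sum_comm]
  exact Finset.sum_congr rfl fun s _ => by rw [← Finset.sum_mul, h.inv]

theorem Stationary.mean_const (h : M.Stationary π) (a : ℝ) : M.mean π (fun _ _ => a) = a := by
  rw [mean_fst, ← Finset.sum_mul, h.sum, one_mul]

/-- The stationary mean of the semi-gradient. -/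
noncomputable def meanGrad (M : Model S d) (γ : ℝ) (π : S → ℝ) (θ : EuclideanSpace ℝ (Fin d)) :
    EuclideanSpace ℝ (Fin d) :=
  ∑ s, ∑ s', (π s * M.P s s') • M.semiGrad γ θ s s'

theorem inner_meanGrad (γ : ℝ) (θ u : EuclideanSpace ℝ (Fin d)) :
    inner ℝ u (M.meanGrad γ π θ) = M.mean π fun s s' => inner ℝ u (M.semiGrad γ θ s s') := by
  simp only [meanGrad, mean, inner_sum, inner_smul_right]

theorem inner_semiGrad (γ : ℝ) (θ u : EuclideanSpace ℝ (Fin d)) (s s' : S) :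
    inner ℝ u (M.semiGrad γ θ s s')
      = (M.reward s s' + γ * M.value θ s' - M.value θ s) * M.value u s := by
  rw [semiGrad, inner_smul_right, value, value, value, real_inner_comm u]

theorem value_sub (θ θ' : EuclideanSpace ℝ (Fin d)) (s : S) :
    M.value (θ - θ') s = M.value θ s - M.value θ' s := by
  simp only [value, inner_sub_right]

theorem abs_value_le (hφ : ∀ s, ‖M.φ s‖ ≤ 1) (θ : EuclideanSpace ℝ (Fin d)) (s : S) :
    |M.value θ s| ≤ ‖θ‖ :=
  (abs_real_inner_le_norm _ _).trans (mul_le_of_le_one_left (norm_nonneg _) (hφ s))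

theorem norm_semiGrad_sub_le {γ : ℝ} (hγ₀ : 0 < γ) (hγ₁ : γ < 1) (hφ : ∀ s, ‖M.φ s‖ ≤ 1)
    (θ θ' : EuclideanSpace ℝ (Fin d)) (s s' : S) :
    ‖M.semiGrad γ θ s s' - M.semiGrad γ θ' s s'‖ ≤ 2 * ‖θ - θ'‖ := by
  have e : M.semiGrad γ θ s s' - M.semiGrad γ θ' s s'
      = (γ * M.value (θ - θ') s' - M.value (θ - θ') s) • M.φ s := by
    rw [semiGrad, semiGrad, ← sub_smul, value_sub, value_sub]
    congr 1
    ring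
  rw [e, norm_smul, Real.norm_eq_abs]
  have h1 := abs_value_le hφ (θ - θ') s
  have h2 := abs_value_le hφ (θ - θ') s'
  have h3 : |γ * M.value (θ - θ') s' - M.value (θ - θ') s| ≤ 2 * ‖θ - θ'‖ := by
    refine (abs_sub _ _).trans ?_
    rw [abs_mul, abs_of_pos hγ₀]
    nlinarith [abs_nonneg (M.value (θ - θ') s'), norm_nonneg (θ - θ')]
  exact (mul_le_of_le_one_right (abs_nonneg _) (hφ s)).trans h3

theorem norm_semiGrad_le {γ B R : ℝ} (hγ₀ : 0 < γ) (hγ₁ : γ < 1) (hφ : ∀ s, ‖M.φ s‖ ≤ 1)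
    (hB : ∀ s s', |M.reward s s'| ≤ B) {θ : EuclideanSpace ℝ (Fin d)} (hθ : ‖θ‖ ≤ R) (s s' : S) :
    ‖M.semiGrad γ θ s s'‖ ≤ B + 2 * R := by
  have h1 := norm_semiGrad_sub_le hγ₀ hγ₁ hφ θ 0 s s'
  have h0 : ‖M.semiGrad γ 0 s s'‖ ≤ B := by
    rw [semiGrad, norm_smul, Real.norm_eq_abs]
    refine (mul_le_of_le_one_right (abs_nonneg _) (hφ s)).trans ?_
    simpa [value] using hB s s'
  rw [sub_zero] at h1
  have := norm_le_norm_add_norm_sub' (M.semiGrad γ θ s s') (M.semiGrad γ 0 s s')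
  linarith

theorem Stationary.norm_sum_smul_le (h : M.Stationary π) {C : ℝ}
    {f : S → S → EuclideanSpace ℝ (Fin d)} (hf : ∀ s s', ‖f s s'‖ ≤ C) :
    ‖∑ s, ∑ s', (π s * M.P s s') • f s s'‖ ≤ C := by
  refine le_trans ?_ (h.mean_const C).le
  refine (norm_sum_le _ _).trans (Finset.sum_le_sum fun s _ => (norm_sum_le _ _).trans
    (Finset.sum_le_sum fun s' _ => ?_))
  have := mul_nonneg (h.nonneg s) (M.P_nonneg s s')
  rw [norm_smul, Real.norm_of_nonneg this]
  exact mul_le_mul_of_nonneg_left (hf s s') this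

theorem Stationary.norm_meanGrad_le (h : M.Stationary π) {γ B R : ℝ} (hγ₀ : 0 < γ) (hγ₁ : γ < 1)
    (hφ : ∀ s, ‖M.φ s‖ ≤ 1) (hB : ∀ s s', |M.reward s s'| ≤ B)
    {θ : EuclideanSpace ℝ (Fin d)} (hθ : ‖θ‖ ≤ R) : ‖M.meanGrad γ π θ‖ ≤ B + 2 * R :=
  h.norm_sum_smul_le fun s s' => norm_semiGrad_le hγ₀ hγ₁ hφ hB hθ s s'

theorem Stationary.norm_meanGrad_sub_le (h : M.Stationary π) {γ : ℝ} (hγ₀ : 0 < γ) (hγ₁ : γ < 1)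
    (hφ : ∀ s, ‖M.φ s‖ ≤ 1) (θ θ' : EuclideanSpace ℝ (Fin d)) :
    ‖M.meanGrad γ π θ - M.meanGrad γ π θ'‖ ≤ 2 * ‖θ - θ'‖ := by
  simp only [meanGrad, ← Finset.sum_sub_distrib, ← smul_sub]
  exact h.norm_sum_smul_le fun s s' => norm_semiGrad_sub_le hγ₀ hγ₁ hφ θ θ' s s'

theorem eq_zero_of_forall_quadratic_nonneg {a b : ℝ} (hb : 0 ≤ b)
    (h : ∀ t : ℝ, 0 ≤ t ^ 2 * b - 2 * t * a) : a = 0 := by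
  -- The minimiser would be `a / b`; `b + 1` also covers `b = 0`.
  have h1 := h (a / (b + 1))
  have hb1 : 0 < b + 1 := by linarith
  have e : (a / (b + 1)) ^ 2 * b - 2 * (a / (b + 1)) * a
      = -(a ^ 2 * (b + 2)) / (b + 1) ^ 2 := by
    field_simp
    ring
  rw [e, le_div_iff₀ (by positivity), zero_mul] at h1
  have h2 : a ^ 2 * (b + 2) = 0 := le_antisymm (by linarith) (by positivity)
  rcases mul_eq_zero.1 h2 with h3 | h3
  · exact pow_eq_zero_iff (two_ne_zero) |>.1 h3
  · linarith

/-- The solution of the projected Bellman equation is a zero of the mean semi-gradient. -/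
theorem Stationary.meanGrad_eq_zero (h : M.Stationary π) {γ : ℝ}
    {θs : EuclideanSpace ℝ (Fin d)} (hs : M.SolvesProjectedBellman γ π θs) :
    M.meanGrad γ π θs = 0 := by
  refine ext_inner_left ℝ fun u => ?_
  rw [inner_zero_right, inner_meanGrad]
  have e : (M.mean π fun s s' => inner ℝ u (M.semiGrad γ θs s s'))
      = ∑ s, π s * ((M.bellman γ (M.value θs) s - M.value θs s) * M.value u s) := by
    refine Finset.sum_congr rfl fun s _ => ?_
    have e1 : ∑ s', M.P s s' * (M.reward s s' + γ * M.value θs s' - M.value θs s)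
        = M.bellman γ (M.value θs) s - M.value θs s := by
      simp only [mul_sub, mul_add, Finset.sum_sub_distrib, Finset.sum_add_distrib,
        ← Finset.sum_mul, M.P_sum, one_mul, bellman, Finset.mul_sum]
      congr 2
      exact Finset.sum_congr rfl fun _ _ => by ring
    rw [← e1, Finset.sum_mul, Finset.mul_sum]
    exact Finset.sum_congr rfl fun s' _ => by simp only [inner_semiGrad]; ring
  rw [e]
  -- First-order optimality of the projection: compare `θs` with `θs + t • u` for all real `t`; the
  -- cross term is the required inner product.
  refine eq_zero_of_forall_quadratic_nonneg (b := ∑ s, π s * M.value u s ^ 2)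
    (Finset.sum_nonneg fun s _ => mul_nonneg (h.nonneg s) (sq_nonneg _)) fun t => ?_
  have h1 := hs (θs + t • u)
  rw [← sub_nonneg] at h1
  refine h1.trans (le_of_eq ?_)
  simp only [weightedSq, Finset.mul_sum]
  rw [← Finset.sum_sub_distrib, ← Finset.sum_sub_distrib]
  refine Finset.sum_congr rfl fun s _ => ?_
  have : M.value (θs + t • u) s = M.value θs s + t * M.value u s := by
    simp only [value, inner_add_right, inner_smul_right]
  rw [this]
  ring

/-- By stationarity both ends of a transition have law `π`, so `V s * V s' ≤ (V s ² + V s' ²) / 2`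
suffices. This replaces the nonexpansiveness of `P` in the `π`-norm. -/
theorem Stationary.mean_value_mul_le (h : M.Stationary π) (V : S → ℝ) :
    M.mean π (fun s s' => V s * V s') ≤ weightedSq π V := by
  have h1 : M.mean π (fun s s' => V s * V s')
      ≤ M.mean π (fun s s' => (1 / 2) * V s ^ 2 + (1 / 2) * V s' ^ 2) :=
    h.mean_mono fun s s' => by nlinarith [sq_nonneg (V s - V s')]
  rw [mean_add, mean_mul, mean_mul, mean_fst fun s => V s ^ 2, h.mean_snd fun s => V s ^ 2] at h1
  rw [weightedSq]
  linarith

/-- Subtracting the vanishing mean semi-gradient at `θs` removes the rewards and leaves a quadratic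
form in the values of `θ - θs`. -/
theorem Stationary.inner_meanGrad_ge (h : M.Stationary π) {γ : ℝ} (hγ₀ : 0 < γ)
    {θs : EuclideanSpace ℝ (Fin d)} (hs : M.SolvesProjectedBellman γ π θs)
    (θ : EuclideanSpace ℝ (Fin d)) :
    (1 - γ) * weightedSq π (M.value (θ - θs)) ≤ inner ℝ (θs - θ) (M.meanGrad γ π θ) := by
  have e : inner ℝ (θs - θ) (M.meanGrad γ π θ)
      = weightedSq π (M.value (θ - θs))
        - γ * M.mean π (fun s s' => M.value (θ - θs) s * M.value (θ - θs) s') := by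
    have e0 : inner ℝ (θs - θ) (M.meanGrad γ π θ)
        = inner ℝ (θs - θ) (M.meanGrad γ π θ) - inner ℝ (θs - θ) (M.meanGrad γ π θs) := by
      rw [h.meanGrad_eq_zero hs, inner_zero_right, sub_zero]
    rw [e0, inner_meanGrad, inner_meanGrad, ← mean_sub, ← mean_mul, weightedSq,
      ← M.mean_fst (π := π) fun s => M.value (θ - θs) s ^ 2, ← mean_sub]
    congr 1
    funext s s'
    rw [inner_semiGrad, inner_semiGrad, value_sub, value_sub, value_sub]
    ring
  rw [e]
  nlinarith [h.mean_value_mul_le (M.value (θ - θs))]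

/-! ### The smallest eigenvalue and the norm of the solution -/

section Spectrum

theorem featureMatrix_mulVec (θ : EuclideanSpace ℝ (Fin d)) (s : S) :
    (M.featureMatrix.mulVec θ.ofLp) s = M.value θ s := by
  simp only [Matrix.mulVec, dotProduct, featureMatrix, Matrix.of_apply, value, PiLp.inner_apply]
  exact Finset.sum_congr rfl fun i _ => by simp [mul_comm]

theorem dotProduct_self_eq (θ : EuclideanSpace ℝ (Fin d)) :
    dotProduct θ.ofLp θ.ofLp = ‖θ‖ ^ 2 := by
  rw [EuclideanSpace.real_norm_sq_eq]
  exact Finset.sum_congr rfl fun i _ => by ring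

variable [DecidableEq S] {ω : ℝ}

theorem dotProduct_gram (θ : EuclideanSpace ℝ (Fin d)) :
    dotProduct θ.ofLp ((M.featureMatrix.transpose * Matrix.diagonal π * M.featureMatrix).mulVec
      θ.ofLp) = weightedSq π (M.value θ) := by
  rw [← Matrix.mulVec_mulVec, ← Matrix.mulVec_mulVec, Matrix.dotProduct_mulVec,
    Matrix.vecMul_transpose]
  simp only [dotProduct, Matrix.mulVec_diagonal, featureMatrix_mulVec, weightedSq]
  exact Finset.sum_congr rfl fun s _ => by ring

/-- Adding `ω` to an eigenvalue of `A - ω • 1` gives an eigenvalue of `A`, hence at least `ω`; so `A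
- ω • 1` is positive semidefinite. -/
theorem IsMinEigenvalue.mul_norm_sq_le (h : M.IsMinEigenvalue π ω)
    (θ : EuclideanSpace ℝ (Fin d)) : ω * ‖θ‖ ^ 2 ≤ weightedSq π (M.value θ) := by
  set A := M.featureMatrix.transpose * Matrix.diagonal π * M.featureMatrix with hA
  have hAh : A.IsHermitian := by
    rw [Matrix.IsHermitian, Matrix.conjTranspose_eq_transpose_of_trivial, hA,
      Matrix.transpose_mul, Matrix.transpose_mul, Matrix.transpose_transpose,
      Matrix.diagonal_transpose, Matrix.mul_assoc]
  have hH : (A - ω • (1 : Matrix (Fin d) (Fin d) ℝ)).IsHermitian := by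
    refine hAh.sub ?_
    rw [Matrix.IsHermitian, Matrix.conjTranspose_eq_transpose_of_trivial, Matrix.transpose_smul,
      Matrix.transpose_one]
  have hpsd : (A - ω • (1 : Matrix (Fin d) (Fin d) ℝ)).PosSemidef := by
    rw [hH.posSemidef_iff_eigenvalues_nonneg]
    intro i
    have h1 := hH.mulVec_eigenvectorBasis i
    rw [Matrix.sub_mulVec, Matrix.smul_mulVec, Matrix.one_mulVec, sub_eq_iff_eq_add,
      ← add_smul] at h1
    have h2 : Module.End.HasEigenvalue (Matrix.toLin' A) (hH.eigenvalues i + ω) := by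
      refine Module.End.hasEigenvalue_of_hasEigenvector
        (x := (hH.eigenvectorBasis i).ofLp) ⟨?_, ?_⟩
      · rw [Module.End.mem_eigenspace_iff, Matrix.toLin'_apply]
        exact h1
      · intro h0
        have : hH.eigenvectorBasis i = 0 := by
          ext j
          exact congrFun h0 j
        exact hH.eigenvectorBasis.orthonormal.ne_zero i this
    have := h.2 h2
    show 0 ≤ hH.eigenvalues i
    linarith
  have := hpsd.dotProduct_mulVec_nonneg θ.ofLp
  rw [star_trivial, Matrix.sub_mulVec, Matrix.smul_mulVec, Matrix.one_mulVec, dotProduct_sub,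
    dotProduct_smul, dotProduct_gram, dotProduct_self_eq, smul_eq_mul] at this
  linarith

theorem IsMinEigenvalue.pos (h : M.IsMinEigenvalue π ω) (hπ : ∀ s, 0 < π s)
    (hrank : M.featureMatrix.rank = d) : 0 < ω := by
  obtain ⟨x, hx, hx0⟩ := h.1.exists_hasEigenvector
  rw [Module.End.mem_eigenspace_iff, Matrix.toLin'_apply] at hx
  set θ : EuclideanSpace ℝ (Fin d) := WithLp.toLp 2 x with hθ
  have hθ0 : θ ≠ 0 := fun h0 => hx0 (by
    have := congrArg WithLp.ofLp h0
    simpa [hθ] using this)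
  have h1 := dotProduct_gram (M := M) (π := π) θ
  have h2 := dotProduct_self_eq θ
  have e : θ.ofLp = x := rfl
  rw [e, hx, dotProduct_smul, ← e, h2, smul_eq_mul] at h1
  have h3 : 0 < weightedSq π (M.value θ) := by
    refine lt_of_le_of_ne (Finset.sum_nonneg fun s _ => mul_nonneg (hπ s).le (sq_nonneg _)) ?_
    intro h0
    have h4 := (Finset.sum_eq_zero_iff_of_nonneg fun s _ =>
      mul_nonneg (hπ s).le (sq_nonneg _)).1 h0.symm
    have h5 : M.featureMatrix.mulVec x = 0 := by
      funext s
      have := h4 s (Finset.mem_univ s)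
      have h6 := pow_eq_zero_iff (two_ne_zero) |>.1 ((mul_eq_zero.1 this).resolve_left (hπ s).ne')
      rw [← e, featureMatrix_mulVec, h6, Pi.zero_apply]
    have hinj : Function.Injective M.featureMatrix.mulVecLin := by
      rw [← LinearMap.ker_eq_bot, ← Submodule.finrank_eq_zero]
      have := M.featureMatrix.mulVecLin.finrank_range_add_finrank_ker
      rw [Module.finrank_fin_fun] at this
      rw [Matrix.rank] at hrank
      omega
    exact hx0 (hinj (by rw [Matrix.mulVecLin_apply, h5, map_zero]))
  rw [← h1] at h3
  exact pos_of_mul_pos_left h3 (sq_nonneg _)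

/-- Testing the zero mean semi-gradient against `θs` itself gives `(1 - γ)² W ≤ B²`, and `ω ‖θs‖² ≤
W`. Having `θs` in the ball is what makes the projection step harmless. -/
theorem Stationary.norm_solution_le (h : M.Stationary π) (hmin : M.IsMinEigenvalue π ω)
    (hω : 0 < ω) {γ B R : ℝ} (hγ₀ : 0 < γ) (hγ₁ : γ < 1) (hB : ∀ s s', |M.reward s s'| ≤ B)
    (hB₀ : 0 ≤ B) (hR : 2 * B / (Real.sqrt ω * (1 - γ) ^ (3 / 2 : ℝ)) ≤ R)
    {θs : EuclideanSpace ℝ (Fin d)} (hs : M.SolvesProjectedBellman γ π θs) : ‖θs‖ ≤ R := by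
  have hg : 0 < 1 - γ := by linarith
  set V := M.value θs with hV
  set W := weightedSq π V with hW
  have hin : inner ℝ θs (M.meanGrad γ π θs) = 0 := by
    rw [h.meanGrad_eq_zero hs, inner_zero_right]
  have e : inner ℝ θs (M.meanGrad γ π θs) = M.mean π (fun s s' => M.reward s s' * V s)
      + γ * M.mean π (fun s s' => V s * V s') - W := by
    rw [inner_meanGrad, ← mean_mul, ← mean_add, hW, weightedSq,
      ← M.mean_fst (π := π) fun s => V s ^ 2, ← mean_sub]
    congr 1
    funext s s'
    rw [inner_semiGrad]
    ring
  have h1 := h.mean_value_mul_le V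
  have h2 : M.mean π (fun s s' => M.reward s s' * V s)
      ≤ B ^ 2 / (2 * (1 - γ)) + (1 - γ) / 2 * W := by
    have : M.mean π (fun s s' => M.reward s s' * V s)
        ≤ M.mean π (fun s s' => B ^ 2 / (2 * (1 - γ)) + (1 - γ) / 2 * V s ^ 2) := by
      refine h.mean_mono fun s s' => ?_
      have h3 : M.reward s s' ^ 2 ≤ B ^ 2 := sq_le_sq' (abs_le.1 (hB s s')).1 (abs_le.1 (hB s s')).2
      have h4 : B ^ 2 / (2 * (1 - γ)) + (1 - γ) / 2 * V s ^ 2 - M.reward s s' * V s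
          = ((B ^ 2 - M.reward s s' ^ 2) + (M.reward s s' - (1 - γ) * V s) ^ 2)
            / (2 * (1 - γ)) := by
        field_simp
        ring
      have h5 : 0 ≤ ((B ^ 2 - M.reward s s' ^ 2) + (M.reward s s' - (1 - γ) * V s) ^ 2)
            / (2 * (1 - γ)) :=
        div_nonneg (add_nonneg (by linarith) (sq_nonneg _)) (by linarith)
      linarith
    rw [mean_add, h.mean_const, mean_mul, mean_fst fun s => V s ^ 2] at this
    exact this
  have h6 : (1 - γ) / 2 * W ≤ B ^ 2 / (2 * (1 - γ)) := by nlinarith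
  have h7 := hmin.mul_norm_sq_le θs
  rw [← hV, ← hW] at h7
  have h8 : (1 - γ) ^ 2 * (ω * ‖θs‖ ^ 2) ≤ B ^ 2 := by
    rw [le_div_iff₀ (by linarith)] at h6
    nlinarith [mul_le_mul_of_nonneg_left h7 (sq_nonneg (1 - γ))]
  have hsq := Real.sq_sqrt hω.le
  have h9 : (1 - γ) * (Real.sqrt ω * ‖θs‖) ≤ B := by
    refine le_of_sq_le_sq ?_ hB₀
    rw [mul_pow, mul_pow, hsq]
    exact h8
  refine le_trans ?_ hR
  -- The argument yields the bound `B / (√ω (1 - γ))`, which is below the assumed one.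
  have hp : (1 - γ) ^ (3 / 2 : ℝ) ≤ 1 - γ := by
    have := Real.rpow_le_rpow_of_exponent_ge hg (by linarith : 1 - γ ≤ 1)
      (by norm_num : (1 : ℝ) ≤ 3 / 2)
    rwa [Real.rpow_one] at this
  have hsp : 0 < Real.sqrt ω := Real.sqrt_pos.2 hω
  rw [le_div_iff₀ (mul_pos hsp (Real.rpow_pos_of_pos hg _))]
  have h10 : ‖θs‖ * (Real.sqrt ω * (1 - γ) ^ (3 / 2 : ℝ)) ≤ ‖θs‖ * (Real.sqrt ω * (1 - γ)) :=
    mul_le_mul_of_nonneg_left (mul_le_mul_of_nonneg_left hp hsp.le) (norm_nonneg _)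
  nlinarith

end Spectrum

/-! ### Noise of the semi-gradient: mean, size, regularity, mixing -/

section Noise

/-- The deviation of the stochastic semi-gradient from its mean, in the direction of `θs - θ`. -/
noncomputable def noise (M : Model S d) (γ : ℝ) (π : S → ℝ) (θs θ : EuclideanSpace ℝ (Fin d)) (s s' : S) : ℝ :=
  inner ℝ (θs - θ) (M.semiGrad γ θ s s' - M.meanGrad γ π θ)

theorem Stationary.mean_noise (h : M.Stationary π) (γ : ℝ) (θs θ : EuclideanSpace ℝ (Fin d)) :
    M.mean π (M.noise γ π θs θ) = 0 := by
  have e : M.noise γ π θs θ = fun s s' => inner ℝ (θs - θ) (M.semiGrad γ θ s s')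
      - inner ℝ (θs - θ) (M.meanGrad γ π θ) := by
    funext s s'
    rw [noise, inner_sub_right]
  rw [e, mean_sub, h.mean_const, inner_meanGrad, sub_self]

theorem Stationary.abs_noise_le (h : M.Stationary π) {γ B R : ℝ} (hγ₀ : 0 < γ) (hγ₁ : γ < 1)
    (hφ : ∀ s, ‖M.φ s‖ ≤ 1) (hB : ∀ s s', |M.reward s s'| ≤ B)
    {θs θ : EuclideanSpace ℝ (Fin d)} (hθs : ‖θs‖ ≤ R) (hθ : ‖θ‖ ≤ R) (s s' : S) :
    |M.noise γ π θs θ s s'| ≤ 4 * R * (B + 2 * R) := by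
  refine (abs_real_inner_le_norm _ _).trans ?_
  have h1 : ‖θs - θ‖ ≤ 2 * R := (norm_sub_le _ _).trans (by linarith)
  have h2 := norm_semiGrad_le hγ₀ hγ₁ hφ hB hθ s s'
  have h3 := h.norm_meanGrad_le hγ₀ hγ₁ hφ hB hθ
  have h4 : ‖M.semiGrad γ θ s s' - M.meanGrad γ π θ‖ ≤ 2 * (B + 2 * R) :=
    (norm_sub_le _ _).trans (by linarith)
  calc _ ≤ (2 * R) * (2 * (B + 2 * R)) :=
        mul_le_mul h1 h4 (norm_nonneg _) ((norm_nonneg _).trans h1)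
    _ = _ := by ring

/-- The noise is Lipschitz in the parameter, with a constant that is small where the
semi-gradient and the error are. -/
theorem Stationary.noise_sub_le (h : M.Stationary π) {γ : ℝ} (hγ₀ : 0 < γ) (hγ₁ : γ < 1)
    (hφ : ∀ s, ‖M.φ s‖ ≤ 1) {θs : EuclideanSpace ℝ (Fin d)}
    (hs : M.SolvesProjectedBellman γ π θs) (θ θ' : EuclideanSpace ℝ (Fin d)) (s s' : S) :
    M.noise γ π θs θ' s s' - M.noise γ π θs θ s s'
      ≤ 6 * (‖θ - θs‖ * ‖θ' - θ‖) + ‖θ' - θ‖ * ‖M.semiGrad γ θ s s'‖ + 4 * ‖θ' - θ‖ ^ 2 := by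
  set D := (M.semiGrad γ θ' s s' - M.semiGrad γ θ s s')
    - (M.meanGrad γ π θ' - M.meanGrad γ π θ) with hD
  have e : M.noise γ π θs θ' s s' - M.noise γ π θs θ s s'
      = inner ℝ (θs - θ) D - inner ℝ (θ' - θ) (M.semiGrad γ θ s s')
        + inner ℝ (θ' - θ) (M.meanGrad γ π θ) - inner ℝ (θ' - θ) D := by
    simp only [noise, hD, inner_sub_left, inner_sub_right]
    ring
  -- `D` contributes 4 to the factor 6, and the mean semi-gradient, which is 2-Lipschitz and zero at
  -- `θs`, contributes 2.
  have hDn : ‖D‖ ≤ 4 * ‖θ' - θ‖ := by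
    have h1 := norm_semiGrad_sub_le hγ₀ hγ₁ hφ θ' θ s s'
    have h2 := h.norm_meanGrad_sub_le hγ₀ hγ₁ hφ θ' θ
    exact (norm_sub_le _ _).trans (by linarith)
  have hmg : ‖M.meanGrad γ π θ‖ ≤ 2 * ‖θ - θs‖ := by
    have := h.norm_meanGrad_sub_le hγ₀ hγ₁ hφ θ θs
    rwa [h.meanGrad_eq_zero hs, sub_zero] at this
  have i1 : inner ℝ (θs - θ) D ≤ ‖θ - θs‖ * (4 * ‖θ' - θ‖) := by
    refine (real_inner_le_norm _ _).trans ?_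
    rw [norm_sub_rev]
    exact mul_le_mul_of_nonneg_left hDn (norm_nonneg _)
  have i2 := neg_le_of_abs_le (abs_real_inner_le_norm (θ' - θ) (M.semiGrad γ θ s s'))
  have i3 : inner ℝ (θ' - θ) (M.meanGrad γ π θ) ≤ ‖θ' - θ‖ * (2 * ‖θ - θs‖) :=
    (real_inner_le_norm _ _).trans (mul_le_mul_of_nonneg_left hmg (norm_nonneg _))
  have i4 : -(inner ℝ (θ' - θ) D) ≤ ‖θ' - θ‖ * (4 * ‖θ' - θ‖) :=
    (neg_le_of_neg_le (neg_le_of_abs_le (abs_real_inner_le_norm _ _))).trans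
      (mul_le_mul_of_nonneg_left hDn (norm_nonneg _))
  rw [e]
  nlinarith

/-- After `t` steps the chain has nearly forgotten its state, so that the mean of the noise
is small. -/
theorem Mixing.abs_sum_noise_le [DecidableEq S] [Nonempty S] {κ ρ : ℝ} (h : M.Mixing π κ ρ)
    {γ H : ℝ} {θs θ : EuclideanSpace ℝ (Fin d)} (hH : ∀ s s', |M.noise γ π θs θ s s'| ≤ H)
    (t : ℕ) (s : S) :
    |∑ s₁, (M.P ^ t) s s₁ * ∑ s₂, M.P s₁ s₂ * M.noise γ π θs θ s₁ s₂| ≤ H * (κ * ρ ^ t) := by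
  set f : S → ℝ := fun s₁ => ∑ s₂, M.P s₁ s₂ * M.noise γ π θs θ s₁ s₂ with hf
  have h0 : ∑ s₁, π s₁ * f s₁ = 0 := by
    rw [← h.stationary.mean_noise γ θs θ, mean]
    refine Finset.sum_congr rfl fun s₁ _ => ?_
    rw [hf, Finset.mul_sum]
    exact Finset.sum_congr rfl fun s₂ _ => by ring
  have hfH : ∀ s₁, |f s₁| ≤ H := fun s₁ => by
    refine (Finset.abs_sum_le_sum_abs _ _).trans ?_
    calc _ ≤ ∑ s₂, M.P s₁ s₂ * H := Finset.sum_le_sum fun s₂ _ => by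
          rw [abs_mul, abs_of_nonneg (M.P_nonneg _ _)]
          exact mul_le_mul_of_nonneg_left (hH _ _) (M.P_nonneg _ _)
      _ = H := by rw [← Finset.sum_mul, M.P_sum, one_mul]
  -- The stationary mean of `f` is zero, so it can be subtracted to bring in the mixing distance.
  have e : ∑ s₁, (M.P ^ t) s s₁ * f s₁ = ∑ s₁, ((M.P ^ t) s s₁ - π s₁) * f s₁ := by
    simp only [sub_mul, Finset.sum_sub_distrib, h0, sub_zero]
  have hH0 : 0 ≤ H := (abs_nonneg _).trans (hfH s)
  show |∑ s₁, (M.P ^ t) s s₁ * f s₁| ≤ _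
  rw [e]
  calc _ ≤ ∑ s₁, |((M.P ^ t) s s₁ - π s₁) * f s₁| := Finset.abs_sum_le_sum_abs _ _
    _ ≤ ∑ s₁, |(M.P ^ t) s s₁ - π s₁| * H := Finset.sum_le_sum fun s₁ _ => by
        rw [abs_mul]
        exact mul_le_mul_of_nonneg_left (hfH _) (abs_nonneg _)
    _ ≤ H * (κ * ρ ^ t) := by
        rw [← Finset.sum_mul, mul_comm]
        exact mul_le_mul_of_nonneg_left (h.bound t s) hH0

end Noise

end Model

/-! ### Regret of the momentum method -/

/-- Regret bound for a projected momentum method with decreasing step sizes. -/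
theorem momentum_regret_le {E : Type*} [NormedAddCommGroup E] [InnerProductSpace ℝ E]
    {θ m g : ℕ → E} {a : ℕ → ℝ} {θs : E} {β D G : ℝ} (hβ₀ : 0 ≤ β) (hβ₁ : β < 1)
    (hm0 : m 0 = 0) (hm : ∀ n, m (n + 1) = β • m n + (1 - β) • g n)
    (hθs : ∀ n, ‖θ (n + 1) - θs‖ ≤ ‖θ n + a (n + 1) • m (n + 1) - θs‖)
    (hθ : ∀ n, ‖θ (n + 1) - θ n‖ ≤ ‖a (n + 1) • m (n + 1)‖)
    (ha : Antitone a) (ha0 : ∀ n, 0 ≤ a n) (hD : ∀ n, ‖θ n - θs‖ ≤ D) (hG : ∀ n, ‖m n‖ ≤ G)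
    (K : ℕ) :
    (1 - β) * ∑ n ∈ Finset.range K, a (n + 1) * inner ℝ (θs - θ n) (g n)
      ≤ (1 - β) / 2 * D ^ 2 + β * (D * G) * a 0
        + ∑ n ∈ Finset.range K, a (n + 1) ^ 2 * ‖m (n + 1)‖ ^ 2 := by
  have hD0 : 0 ≤ D := (norm_nonneg _).trans (hD 0)
  have hU : ∀ n, |inner ℝ (θ n - θs) (m n)| ≤ D * G := fun n =>
    (abs_real_inner_le_norm _ _).trans (mul_le_mul (hD n) (hG n) (norm_nonneg _) hD0)
  -- Of the correlation with the new momentum, a fraction `1 - β` is paid by the squared distance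
  -- and a fraction `β` by the momentum term. The last term keeps `Ψ` nonnegative and absorbs the
  -- decrease of the step size.
  set Ψ : ℕ → ℝ := fun n => (1 - β) / 2 * ‖θ n - θs‖ ^ 2
    + β * (a n * inner ℝ (θ n - θs) (m n)) + β * (D * G) * a n with hΨ
  have step : ∀ n, (1 - β) * (a (n + 1) * inner ℝ (θs - θ n) (g n))
      ≤ a (n + 1) ^ 2 * ‖m (n + 1)‖ ^ 2 - (Ψ (n + 1) - Ψ n) := by
    intro n
    set T := inner ℝ (θ n - θs) (m (n + 1)) with hT
    set N := a (n + 1) ^ 2 * ‖m (n + 1)‖ ^ 2 with hN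
    have hN0 : 0 ≤ N := by positivity
    have e1 : T = β * inner ℝ (θ n - θs) (m n) - (1 - β) * inner ℝ (θs - θ n) (g n) := by
      rw [hT, hm, inner_add_right, inner_smul_right, inner_smul_right, ← neg_sub (θ n) θs,
        inner_neg_left]
      ring
    have e2 : ‖θ (n + 1) - θs‖ ^ 2 ≤ ‖θ n - θs‖ ^ 2 + 2 * (a (n + 1) * T) + N := by
      refine (pow_le_pow_left₀ (norm_nonneg _) (hθs n) 2).trans (le_of_eq ?_)
      rw [add_sub_right_comm, norm_add_sq_real, inner_smul_right, norm_smul, mul_pow,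
        Real.norm_eq_abs, sq_abs]
    have e3 : a (n + 1) * inner ℝ (θ (n + 1) - θs) (m (n + 1)) ≤ a (n + 1) * T + N := by
      have : inner ℝ (θ (n + 1) - θs) (m (n + 1))
          = T + inner ℝ (θ (n + 1) - θ n) (m (n + 1)) := by
        rw [hT, ← inner_add_left]
        congr 1
        abel
      rw [this, mul_add]
      have h1 : inner ℝ (θ (n + 1) - θ n) (m (n + 1)) ≤ a (n + 1) * ‖m (n + 1)‖ * ‖m (n + 1)‖ := by
        refine (real_inner_le_norm _ _).trans (mul_le_mul_of_nonneg_right ?_ (norm_nonneg _))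
        have := hθ n
        rwa [norm_smul, Real.norm_of_nonneg (ha0 _)] at this
      have h2 := mul_le_mul_of_nonneg_left h1 (ha0 (n + 1))
      rw [hN]
      linarith [h2, (by ring : a (n + 1) * (a (n + 1) * ‖m (n + 1)‖ * ‖m (n + 1)‖)
        = a (n + 1) ^ 2 * ‖m (n + 1)‖ ^ 2)]
    have e4 : a (n + 1) * inner ℝ (θ n - θs) (m n)
        ≤ a n * inner ℝ (θ n - θs) (m n) + (a n - a (n + 1)) * (D * G) := by
      have h1 := (abs_le.1 (hU n)).1
      have h2 : 0 ≤ a n - a (n + 1) := sub_nonneg.2 (ha n.le_succ)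
      nlinarith
    have e5 : (1 - β) * (a (n + 1) * inner ℝ (θs - θ n) (g n))
        = β * (a (n + 1) * inner ℝ (θ n - θs) (m n)) - a (n + 1) * T := by
      rw [e1]
      ring
    have e6 := mul_le_mul_of_nonneg_left e2 (by linarith : 0 ≤ (1 - β) / 2)
    have e7 := mul_le_mul_of_nonneg_left e3 hβ₀
    have e8 := mul_le_mul_of_nonneg_left e4 hβ₀
    have e9 : (1 - β) / 2 * N + β * N ≤ N := by nlinarith
    rw [e5]
    simp only [hΨ]
    nlinarith
  have hsum := Finset.sum_le_sum fun n (_ : n ∈ Finset.range K) => step n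
  rw [← Finset.mul_sum, Finset.sum_sub_distrib, Finset.sum_range_sub Ψ] at hsum
  have hK : 0 ≤ Ψ K := by
    have h1 := (abs_le.1 (hU K)).1
    have h2 : 0 ≤ β * a K * (inner ℝ (θ K - θs) (m K) + D * G) :=
      mul_nonneg (mul_nonneg hβ₀ (ha0 K)) (by linarith)
    have h3 : 0 ≤ (1 - β) / 2 * ‖θ K - θs‖ ^ 2 :=
      mul_nonneg (by linarith) (sq_nonneg _)
    simp only [hΨ]
    nlinarith
  have h0 : Ψ 0 ≤ (1 - β) / 2 * D ^ 2 + β * (D * G) * a 0 := by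
    simp only [hΨ, hm0, inner_zero_right, mul_zero, add_zero]
    have := mul_le_mul_of_nonneg_left (pow_le_pow_left₀ (norm_nonneg _) (hD 0) 2)
      (by linarith : 0 ≤ (1 - β) / 2)
    linarith
  linarith

theorem norm_sq_exp_average_le {E : Type*} [NormedAddCommGroup E] [NormedSpace ℝ E]
    {β : ℝ} (hβ₀ : 0 ≤ β) (hβ₁ : β < 1) (x y : E) :
    ‖β • x + (1 - β) • y‖ ^ 2 ≤ β * ‖x‖ ^ 2 + (1 - β) * ‖y‖ ^ 2 := by
  have h1 : ‖β • x + (1 - β) • y‖ ≤ β * ‖x‖ + (1 - β) * ‖y‖ := by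
    refine (norm_add_le _ _).trans (le_of_eq ?_)
    rw [norm_smul, norm_smul, Real.norm_of_nonneg hβ₀,
      Real.norm_of_nonneg (by linarith : 0 ≤ 1 - β)]
  refine (pow_le_pow_left₀ (norm_nonneg _) h1 2).trans ?_
  nlinarith [mul_nonneg (mul_nonneg hβ₀ (by linarith : 0 ≤ 1 - β)) (sq_nonneg (‖x‖ - ‖y‖))]

/-- Products become squares that can be summed: `q²` goes to half of the drift, `a² g²` to the
logarithmic sum, `Δ²` to the window sum. -/
theorem young_split {a a₀ c q Δ g : ℝ} (hc : 0 < c) (ha : 0 ≤ a) (haa : a ≤ a₀) :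
    a * (6 * (q * Δ) + Δ * g + 4 * Δ ^ 2)
      ≤ c / 2 * (a * q ^ 2) + 1 / 2 * (a ^ 2 * g ^ 2)
        + (18 * a₀ / c + 4 * a₀ + 1 / 2) * Δ ^ 2 := by
  have h1 : 6 * (q * Δ) ≤ c / 2 * q ^ 2 + 18 / c * Δ ^ 2 := by
    have : c / 2 * q ^ 2 + 18 / c * Δ ^ 2 - 6 * (q * Δ) = (c * q - 6 * Δ) ^ 2 / (2 * c) := by
      field_simp
      ring
    have h2 : 0 ≤ (c * q - 6 * Δ) ^ 2 / (2 * c) := by positivity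
    linarith
  have h2 := mul_le_mul_of_nonneg_left h1 ha
  have h3 : a * (Δ * g) ≤ 1 / 2 * (a ^ 2 * g ^ 2) + 1 / 2 * Δ ^ 2 := by
    nlinarith [sq_nonneg (a * g - Δ)]
  have h4 : a * (18 / c * Δ ^ 2) ≤ a₀ * (18 / c * Δ ^ 2) :=
    mul_le_mul_of_nonneg_right haa (by positivity)
  have h5 : a * (4 * Δ ^ 2) ≤ a₀ * (4 * Δ ^ 2) := mul_le_mul_of_nonneg_right haa (by positivity)
  have e : 18 * a₀ / c = a₀ * (18 / c) := by ring
  rw [e]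
  nlinarith

/-- The step size that belongs to a memory. -/
noncomputable def State.stepSize {d : ℕ} (η δ : ℝ) (y : State d) : ℝ := η / Real.sqrt (y.v + δ)

/-! ### Estimates along a single trajectory -/

section Run

variable {S : Type*} [Fintype S] {d : ℕ} (M : Model S d) (γ R β η δ : ℝ)
  (θ₀ : EuclideanSpace ℝ (Fin d)) (x : ℕ → S)

theorem run_succ_m (n : ℕ) : (run M γ R β η δ θ₀ x (n + 1)).m
    = β • (run M γ R β η δ θ₀ x n).m
      + (1 - β) • M.semiGrad γ (run M γ R β η δ θ₀ x n).θ (x (n + 1)) (x (n + 2)) := rfl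

theorem run_succ_v (n : ℕ) : (run M γ R β η δ θ₀ x (n + 1)).v
    = (run M γ R β η δ θ₀ x n).v
      + ‖M.semiGrad γ (run M γ R β η δ θ₀ x n).θ (x (n + 1)) (x (n + 2))‖ ^ 2 := rfl

theorem monotone_run_v : Monotone fun n => (run M γ R β η δ θ₀ x n).v :=
  monotone_nat_of_le_succ fun n => by
    rw [run_succ_v]
    exact le_add_of_nonneg_right (sq_nonneg _)

theorem run_v_nonneg (n : ℕ) : 0 ≤ (run M γ R β η δ θ₀ x n).v :=
  monotone_run_v M γ R β η δ θ₀ x (Nat.zero_le n)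

variable {M γ R β η δ θ₀}

theorem stepSize_run_nonneg (hη : 0 < η) (n : ℕ) :
    0 ≤ (run M γ R β η δ θ₀ x n).stepSize η δ :=
  div_nonneg hη.le (Real.sqrt_nonneg _)

theorem stepSize_run_zero : (run M γ R β η δ θ₀ x 0).stepSize η δ = η / Real.sqrt δ := by
  simp [State.stepSize, run]

theorem antitone_stepSize_run (hη : 0 < η) (hδ : 0 < δ) :
    Antitone fun n => (run M γ R β η δ θ₀ x n).stepSize η δ := fun i j hij => by
  have h0 := run_v_nonneg M γ R β η δ θ₀ x i
  refine div_le_div_of_nonneg_left hη.le (Real.sqrt_pos.2 (by linarith)) (Real.sqrt_le_sqrt ?_)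
  have := monotone_run_v M γ R β η δ θ₀ x hij
  simp only at this
  linarith

theorem stepSize_run_sq (hδ : 0 < δ) (n : ℕ) :
    (run M γ R β η δ θ₀ x n).stepSize η δ ^ 2
      = η ^ 2 / ((run M γ R β η δ θ₀ x n).v + δ) := by
  have h0 := run_v_nonneg M γ R β η δ θ₀ x n
  rw [State.stepSize, div_pow, Real.sq_sqrt (by linarith)]

theorem norm_run_θ_le (hR : 0 ≤ R) (hθ₀ : ‖θ₀‖ ≤ R) (n : ℕ) :
    ‖(run M γ R β η δ θ₀ x n).θ‖ ≤ R := by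
  cases n with
  | zero => exact hθ₀
  | succ n => exact norm_projBall_le hR _

theorem norm_run_m_le (hβ₀ : 0 ≤ β) (hβ₁ : β < 1) {G : ℝ} (hG₀ : 0 ≤ G)
    (hG : ∀ n, ‖M.semiGrad γ (run M γ R β η δ θ₀ x n).θ (x (n + 1)) (x (n + 2))‖ ≤ G) (n : ℕ) :
    ‖(run M γ R β η δ θ₀ x n).m‖ ≤ G := by
  induction n with
  | zero => simpa [run] using hG₀
  | succ n ih =>
    rw [run_succ_m]
    refine (norm_add_le _ _).trans ?_
    rw [norm_smul, norm_smul, Real.norm_of_nonneg hβ₀,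
      Real.norm_of_nonneg (by linarith : 0 ≤ 1 - β)]
    nlinarith [hG n]

theorem run_v_le {G : ℝ}
    (hG : ∀ n, ‖M.semiGrad γ (run M γ R β η δ θ₀ x n).θ (x (n + 1)) (x (n + 2))‖ ≤ G) (n : ℕ) :
    (run M γ R β η δ θ₀ x n).v ≤ n * G ^ 2 := by
  induction n with
  | zero => simp [run]
  | succ n ih =>
    rw [run_succ_v]
    have := pow_le_pow_left₀ (norm_nonneg _) (hG n) 2
    push_cast
    linarith

theorem sum_sq_stepSize_grad_le (hδ : 0 < δ) {G : ℝ}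
    (hG : ∀ n, ‖M.semiGrad γ (run M γ R β η δ θ₀ x n).θ (x (n + 1)) (x (n + 2))‖ ≤ G) (K : ℕ) :
    ∑ n ∈ Finset.range K, (run M γ R β η δ θ₀ x (n + 1)).stepSize η δ ^ 2
        * ‖M.semiGrad γ (run M γ R β η δ θ₀ x n).θ (x (n + 1)) (x (n + 2))‖ ^ 2
      ≤ η ^ 2 * Real.log (1 + K * G ^ 2 / δ) := by
  have h := sum_div_le_log hδ (v := fun n => (run M γ R β η δ θ₀ x n).v) rfl
    (monotone_run_v M γ R β η δ θ₀ x) K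
  have h1 : Real.log (1 + (run M γ R β η δ θ₀ x K).v / δ) ≤ Real.log (1 + K * G ^ 2 / δ) := by
    have h0 := run_v_nonneg M γ R β η δ θ₀ x K
    refine Real.log_le_log (by positivity) ?_
    have := div_le_div_of_nonneg_right (run_v_le x hG K) hδ.le
    linarith
  refine le_trans (le_of_eq ?_) (mul_le_mul_of_nonneg_left (h.trans h1) (sq_nonneg η))
  rw [Finset.mul_sum]
  refine Finset.sum_congr rfl fun n _ => ?_
  rw [stepSize_run_sq x hδ, run_succ_v M γ R β η δ θ₀ x n]
  ring

/-- As the step sizes decrease, `a n ^ 2 * ‖m n‖ ^ 2` is itself dominated by an exponential average,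
so momentum costs no more than the gradients. -/
theorem sum_sq_stepSize_m_le (hβ₀ : 0 ≤ β) (hβ₁ : β < 1) (hη : 0 < η) (hδ : 0 < δ) {G : ℝ}
    (hG : ∀ n, ‖M.semiGrad γ (run M γ R β η δ θ₀ x n).θ (x (n + 1)) (x (n + 2))‖ ≤ G) (K : ℕ) :
    ∑ n ∈ Finset.range K, (run M γ R β η δ θ₀ x (n + 1)).stepSize η δ ^ 2
        * ‖(run M γ R β η δ θ₀ x (n + 1)).m‖ ^ 2
      ≤ η ^ 2 * Real.log (1 + K * G ^ 2 / δ) := by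
  refine le_trans (sum_le_of_exp_average (y := fun n => (run M γ R β η δ θ₀ x n).stepSize η δ ^ 2
        * ‖(run M γ R β η δ θ₀ x n).m‖ ^ 2) hβ₀ hβ₁ (fun n => by positivity) (by simp [run])
      (fun n => ?_) K) (sum_sq_stepSize_grad_le x hδ hG K)
  have h1 := norm_sq_exp_average_le hβ₀ hβ₁ (run M γ R β η δ θ₀ x n).m
    (M.semiGrad γ (run M γ R β η δ θ₀ x n).θ (x (n + 1)) (x (n + 2)))
  rw [← run_succ_m] at h1
  have h2 := pow_le_pow_left₀ (stepSize_run_nonneg x hη (n + 1))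
    (antitone_stepSize_run (M := M) (γ := γ) (R := R) (β := β) (θ₀ := θ₀) x hη hδ n.le_succ) 2
  have h3 := mul_le_mul_of_nonneg_left h1
    (sq_nonneg ((run M γ R β η δ θ₀ x (n + 1)).stepSize η δ))
  have h4 := mul_le_mul_of_nonneg_right h2
    (mul_nonneg hβ₀ (sq_nonneg ‖(run M γ R β η δ θ₀ x n).m‖))
  simp only at h2 h4 ⊢
  nlinarith

/-- Pathwise bound for the accumulated error in terms of the noise seen from `τ` steps before. -/
theorem sum_error_add_noise_le {B c₀ : ℝ} {π : S → ℝ} {θs : EuclideanSpace ℝ (Fin d)}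
    (hπ : M.Stationary π) (hγ₀ : 0 < γ) (hγ₁ : γ < 1) (hR : 0 < R) (hB₀ : 0 ≤ B)
    (hβ₀ : 0 ≤ β) (hβ₁ : β < 1) (hη : 0 < η) (hδ : 0 < δ)
    (hφ : ∀ s, ‖M.φ s‖ ≤ 1) (hB : ∀ s s', |M.reward s s'| ≤ B)
    (hs : M.SolvesProjectedBellman γ π θs) (hθs : ‖θs‖ ≤ R) (hθ₀ : ‖θ₀‖ ≤ R) (hc₀ : 0 < c₀)
    (hdrift : ∀ θ, c₀ * ‖θ - θs‖ ^ 2 ≤ inner ℝ (θs - θ) (M.meanGrad γ π θ))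
    {τ : ℕ} (hτ : 1 ≤ τ) (K : ℕ) :
    c₀ / 2 * ∑ n ∈ Finset.range K, (run M γ R β η δ θ₀ x (n + 1)).stepSize η δ
          * ‖(run M γ R β η δ θ₀ x n).θ - θs‖ ^ 2
      + ∑ n ∈ Finset.range K, (run M γ R β η δ θ₀ x (n - τ)).stepSize η δ
          * M.noise γ π θs (run M γ R β η δ θ₀ x (n - τ)).θ (x (n + 1)) (x (n + 2))
      ≤ (2 * R ^ 2 + 2 * R * (B + 2 * R) * (η / Real.sqrt δ) / (1 - β))
        + (1 / (1 - β) + 18 * (η / Real.sqrt δ) / c₀ + 4 * (η / Real.sqrt δ) + 1) * τ ^ 2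
          * (η ^ 2 * Real.log (1 + K * (B + 2 * R) ^ 2 / δ))
        + 4 * R * (B + 2 * R) * (η / Real.sqrt δ) * (τ + 1) := by
  set r := run M γ R β η δ θ₀ x with hr
  set a : ℕ → ℝ := fun n => (r n).stepSize η δ with ha
  set g : ℕ → EuclideanSpace ℝ (Fin d) :=
    fun n => M.semiGrad γ (r n).θ (x (n + 1)) (x (n + 2)) with hg
  set G := B + 2 * R with hGdef
  set a₀ := η / Real.sqrt δ with ha₀
  set H := 4 * R * G with hH
  set L := η ^ 2 * Real.log (1 + K * G ^ 2 / δ) with hL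
  set N : ℕ → ℝ := fun n => a (n + 1) ^ 2 * ‖(r (n + 1)).m‖ ^ 2 with hN
  have hG₀ : 0 ≤ G := by positivity
  have hθR : ∀ n, ‖(r n).θ‖ ≤ R := norm_run_θ_le x hR.le hθ₀
  have hgG : ∀ n, ‖g n‖ ≤ G := fun n => Model.norm_semiGrad_le hγ₀ hγ₁ hφ hB (hθR n) _ _
  have hmG : ∀ n, ‖(r n).m‖ ≤ G := norm_run_m_le x hβ₀ hβ₁ hG₀ hgG
  have hanti : Antitone a := antitone_stepSize_run x hη hδ
  have hann : ∀ n, 0 ≤ a n := stepSize_run_nonneg x hη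
  have ha0 : a 0 = a₀ := stepSize_run_zero x
  have hale : ∀ n, a n ≤ a₀ := fun n => ha0 ▸ hanti (Nat.zero_le n)
  have hsumN : ∑ n ∈ Finset.range K, N n ≤ L := sum_sq_stepSize_m_le x hβ₀ hβ₁ hη hδ hgG K
  have hsumg : ∑ n ∈ Finset.range K, a (n + 1) ^ 2 * ‖g n‖ ^ 2 ≤ L :=
    sum_sq_stepSize_grad_le x hδ hgG K
  have hL0 : 0 ≤ L :=
    (Finset.sum_nonneg fun n _ => mul_nonneg (sq_nonneg _) (sq_nonneg _)).trans hsumN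
  have hmove : ∀ n, ‖(r (n + 1)).θ - (r n).θ‖ ≤ ‖a (n + 1) • (r (n + 1)).m‖ := fun n => by
    have := norm_projBall_sub_le hR.le
      ((r n).θ + a (n + 1) • (r (n + 1)).m) (hθR n)
    rwa [add_sub_cancel_left] at this
  have hreg := momentum_regret_le (θ := fun n => (r n).θ) (m := fun n => (r n).m) (g := g) (a := a)
    (θs := θs) (D := 2 * R) hβ₀ hβ₁ rfl (fun n => rfl)
    (fun n => norm_projBall_sub_le hR.le _ hθs) hmove hanti hann
    (fun n => (norm_sub_le _ _).trans (by linarith [hθR n])) hmG K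
  have hmoveN : ∀ n, ‖(r (n + 1)).θ - (r n).θ‖ ^ 2 ≤ N n := fun n => by
    refine (pow_le_pow_left₀ (norm_nonneg _) (hmove n) 2).trans (le_of_eq ?_)
    rw [norm_smul, mul_pow, Real.norm_eq_abs, sq_abs]
  have hdelay := fun n => norm_sub_delay_sq_le (fun n => (r n).θ) N hmoveN τ n
  have hsumΔ : ∑ n ∈ Finset.range K, ‖(r (n - τ)).θ - (r n).θ‖ ^ 2 ≤ τ ^ 2 * L := by
    have h1 := sum_window_le (f := N) (fun n => mul_nonneg (sq_nonneg _) (sq_nonneg _)) τ K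
    calc _ ≤ ∑ n ∈ Finset.range K, τ * ∑ j ∈ Finset.Ico (n - τ) n, N j :=
          Finset.sum_le_sum fun n _ => hdelay n
      _ ≤ τ * (τ * ∑ n ∈ Finset.range K, N n) := by
          rw [← Finset.mul_sum]
          exact mul_le_mul_of_nonneg_left h1 (Nat.cast_nonneg _)
      _ ≤ τ * (τ * L) := by gcongr
      _ = _ := by ring
  have hsuma := sum_delay_sub_le hanti hann τ K
  set W := 18 * a₀ / c₀ + 4 * a₀ + 1 / 2 with hW
  -- The semi-gradient splits into drift plus noise at `n`. Moving the noise to parameter `n - τ`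
  -- costs the Young terms; moving its weight from `a (n + 1)` to `a (n - τ)` costs `H` times their
  -- difference. For `n < τ` the truncated `n - τ` is the initial index.
  have step : ∀ n, c₀ / 2 * (a (n + 1) * ‖(r n).θ - θs‖ ^ 2)
      + a (n - τ) * M.noise γ π θs (r (n - τ)).θ (x (n + 1)) (x (n + 2))
      ≤ a (n + 1) * inner ℝ (θs - (r n).θ) (g n) + 1 / 2 * (a (n + 1) ^ 2 * ‖g n‖ ^ 2)
        + W * ‖(r (n - τ)).θ - (r n).θ‖ ^ 2 + H * (a (n - τ) - a (n + 1)) := by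
    intro n
    have h1 := hdrift (r n).θ
    have h2 : inner ℝ (θs - (r n).θ) (g n) = inner ℝ (θs - (r n).θ) (M.meanGrad γ π (r n).θ)
        + M.noise γ π θs (r n).θ (x (n + 1)) (x (n + 2)) := by
      rw [Model.noise, inner_sub_right]
      ring
    have h3 := hπ.noise_sub_le hγ₀ hγ₁ hφ hs (r n).θ (r (n - τ)).θ (x (n + 1)) (x (n + 2))
    have h4 := young_split (q := ‖(r n).θ - θs‖) (Δ := ‖(r (n - τ)).θ - (r n).θ‖) (g := ‖g n‖)
      hc₀ (hann (n + 1)) (hale (n + 1))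
    have h5 := (le_abs_self _).trans (hπ.abs_noise_le hγ₀ hγ₁ hφ hB hθs (hθR (n - τ))
      (x (n + 1)) (x (n + 2)))
    have h6 : 0 ≤ a (n - τ) - a (n + 1) := sub_nonneg.2 (hanti (by omega))
    have h7 := mul_le_mul_of_nonneg_left h5 h6
    have h8 := mul_le_mul_of_nonneg_left h3 (hann (n + 1))
    have h9 := mul_le_mul_of_nonneg_left h1 (hann (n + 1))
    rw [← hW] at h4
    rw [h2]
    linarith
  have hsum := Finset.sum_le_sum fun n (_ : n ∈ Finset.range K) => step n
  simp only [Finset.sum_add_distrib, ← Finset.mul_sum] at hsum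
  have hβ : 0 < 1 - β := by linarith
  have hreg' : ∑ n ∈ Finset.range K, a (n + 1) * inner ℝ (θs - (r n).θ) (g n)
      ≤ 2 * R ^ 2 + 2 * R * G * a₀ / (1 - β) + 1 / (1 - β) * L := by
    have e : 2 * R ^ 2 + 2 * R * G * a₀ / (1 - β) + 1 / (1 - β) * L
        = ((1 - β) * (2 * R ^ 2) + 2 * R * G * a₀ + L) / (1 - β) := by
      field_simp
    rw [e, le_div_iff₀ hβ, mul_comm]
    refine hreg.trans ?_
    rw [ha0]
    have : β * (2 * R * G) * a₀ ≤ 2 * R * G * a₀ := by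
      have : 0 ≤ 2 * R * G * a₀ := by positivity
      nlinarith
    linarith
  have hW0 : 0 ≤ W := by positivity
  have hΔ := mul_le_mul_of_nonneg_left hsumΔ hW0
  have haa := mul_le_mul_of_nonneg_left hsuma (by positivity : 0 ≤ H)
  rw [ha0] at haa
  have hτ2 : L ≤ τ ^ 2 * L := by
    have : (1 : ℝ) ≤ τ := by exact_mod_cast hτ
    exact le_mul_of_one_le_left hL0 (one_le_pow₀ this)
  have hβL : 1 / (1 - β) * L ≤ 1 / (1 - β) * (τ ^ 2 * L) :=
    mul_le_mul_of_nonneg_left hτ2 (by positivity)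
  have e : (1 / (1 - β) + 18 * a₀ / c₀ + 4 * a₀ + 1) * τ ^ 2 * L
      = 1 / (1 - β) * (τ ^ 2 * L) + W * (τ ^ 2 * L) + 1 / 2 * (τ ^ 2 * L) := by
    rw [hW]
    ring
  rw [e]
  linarith

end Run

/-! ### Markov property for functions of finitely many states -/

section Chain

variable {S : Type*}

/-- A function of trajectories that depends on the states up to time `n` only. -/
def Past {α : Type*} (n : ℕ) (F : (ℕ → S) → α) : Prop :=
  ∀ x y : ℕ → S, (∀ i ≤ n, x i = y i) → F x = F y

theorem Past.mono {α : Type*} {n m : ℕ} (h : n ≤ m) {F : (ℕ → S) → α} (hF : Past n F) :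
    Past m F := fun x y hxy => hF x y fun i hi => hxy i (hi.trans h)

/-- The trajectory up to time `n`, as an element of a finite type. -/
def initial (n : ℕ) (x : ℕ → S) (i : Fin (n + 1)) : S := x i

/-- The trajectory that starts as prescribed and then stays where it is. -/
def extend (n : ℕ) (y : Fin (n + 1) → S) (i : ℕ) : S :=
  y ⟨min i n, by omega⟩

theorem Past.extend_initial {α : Type*} {n : ℕ} {F : (ℕ → S) → α} (hF : Past n F)
    (x : ℕ → S) : F (extend n (initial n x)) = F x :=
  hF _ _ fun i hi => by simp only [extend, initial, min_eq_left hi]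

theorem measurable_initial [MeasurableSpace S] {Ω : Type*} [MeasurableSpace Ω]
    {X : ℕ → Ω → S} (hX : ∀ k, Measurable (X k)) (n : ℕ) :
    Measurable fun w => initial n fun i => X i w :=
  measurable_pi_lambda _ fun i => hX i

variable [Fintype S] [MeasurableSpace S] [MeasurableSingletonClass S]
  {Ω : Type*} [MeasurableSpace Ω] {μ : Measure Ω} [IsProbabilityMeasure μ]
  {P : Matrix S S ℝ} {X : ℕ → Ω → S}

theorem Past.integrable (hX : ∀ k, Measurable (X k)) {n : ℕ} {F : (ℕ → S) → ℝ}
    (hF : Past n F) : Integrable (fun w => F fun i => X i w) μ := by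
  have e : (fun w => F fun i => X i w)
      = (fun y => F (extend n y)) ∘ fun w => initial n fun i => X i w := by
    funext w
    exact (hF.extend_initial _).symm
  rw [e]
  have : IsProbabilityMeasure (μ.map fun w => initial n fun i => X i w) :=
    Measure.isProbabilityMeasure_map (measurable_initial hX n).aemeasurable
  exact (Integrable.of_finite (μ := μ.map fun w => initial n fun i => X i w)).comp_measurable
    (measurable_initial hX n)

theorem Past.integral_eq (hX : ∀ k, Measurable (X k)) {n : ℕ} {F : (ℕ → S) → ℝ}
    (hF : Past n F) : ∫ w, F (fun i => X i w) ∂μ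
      = ∑ y : Fin (n + 1) → S, μ.real {w | ∀ i ≤ n, X i w = extend n y i} * F (extend n y) := by
  have hm := measurable_initial hX n
  have : IsProbabilityMeasure (μ.map fun w => initial n fun i => X i w) :=
    Measure.isProbabilityMeasure_map hm.aemeasurable
  have e : ∫ w, F (fun i => X i w) ∂μ
      = ∫ y, F (extend n y) ∂(μ.map fun w => initial n fun i => X i w) := by
    rw [integral_map hm.aemeasurable (Integrable.of_finite).aestronglyMeasurable]
    exact integral_congr_ae (ae_of_all _ fun w => (hF.extend_initial _).symm)
  rw [e, integral_fintype Integrable.of_finite]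
  refine Finset.sum_congr rfl fun y _ => ?_
  rw [smul_eq_mul, map_measureReal_apply hm (measurableSet_singleton y)]
  congr 2
  ext w
  simp only [Set.mem_preimage, Set.mem_singleton_iff, Set.mem_ofPred_eq, funext_iff, initial,
    extend]
  constructor
  · intro h i hi
    rw [← h]
    simp only [min_eq_left hi]
  · intro h i
    rw [h i (by omega)]
    congr 1
    ext
    exact min_eq_left (by omega)

/-- The Markov property for the expectation of a function of the past and the next state. -/
theorem IsMarkovChain.integral_next (hX : IsMarkovChain P X μ) {n : ℕ}
    {F : (ℕ → S) → S → ℝ} (hF : ∀ s, Past n fun x => F x s) :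
    ∫ w, F (fun i => X i w) (X (n + 1) w) ∂μ
      = ∫ w, ∑ s, P (X n w) s * F (fun i => X i w) s ∂μ := by
  have hF' : ∀ s x y, (∀ i ≤ n, x i = y i) → F x s = F y s := hF
  have h1 : Past (n + 1) fun x : ℕ → S => F x (x (n + 1)) := fun x y hxy => by
    simp only [hxy (n + 1) le_rfl]
    exact hF _ x y fun i hi => hxy i (by omega)
  have h2 : Past n fun x : ℕ → S => ∑ s, P (x n) s * F x s := fun x y hxy =>
    Finset.sum_congr rfl fun s _ => by
      rw [hxy n le_rfl, hF' s x y hxy]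
  -- Both expectations are finite sums over paths; a path up to `n + 1` is a path up to `n` with one
  -- more state attached.
  rw [h1.integral_eq hX.measurable, h2.integral_eq hX.measurable,
    ← (Fin.snocEquiv fun _ : Fin (n + 2) => S).sum_comp, Fintype.sum_prod_type, Finset.sum_comm]
  refine Finset.sum_congr rfl fun y _ => ?_
  rw [Finset.mul_sum]
  refine Finset.sum_congr rfl fun s _ => ?_
  set z := extend (n + 1) (Fin.snocEquiv (fun _ : Fin (n + 2) => S) (s, y)) with hz
  have hzi : ∀ i ≤ n, z i = extend n y i := by
    intro i hi
    have e1 : (⟨min i (n + 1), by omega⟩ : Fin (n + 2)) = Fin.castSucc ⟨min i n, by omega⟩ := by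
      ext
      simp only [Fin.val_castSucc]
      omega
    rw [hz, extend, extend, e1]
    exact Fin.snoc_castSucc (α := fun _ => S) s y _
  have hzn : z (n + 1) = s := by
    have e1 : (⟨min (n + 1) (n + 1), by omega⟩ : Fin (n + 2)) = Fin.last (n + 1) := by
      ext
      simp
    rw [hz, extend, e1]
    simp [Fin.snocEquiv]
  rw [hX.markov n z, hzn, hF' s z (extend n y) hzi, hzi n le_rfl]
  have e : {w | ∀ i ≤ n, X i w = z i} = {w | ∀ i ≤ n, X i w = extend n y i} := by
    ext w
    exact forall₂_congr fun i hi => by rw [hzi i hi]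
  rw [e]
  ring

theorem IsMarkovChain.integral_later [DecidableEq S] (hX : IsMarkovChain P X μ) {n : ℕ} (t : ℕ)
    {F : (ℕ → S) → S → ℝ} (hF : ∀ s, Past n fun x => F x s) :
    ∫ w, F (fun i => X i w) (X (n + t) w) ∂μ
      = ∫ w, ∑ s, (P ^ t) (X n w) s * F (fun i => X i w) s ∂μ := by
  induction t generalizing F with
  | zero => simp [Matrix.one_apply]
  | succ t ih =>
    have h1 := hX.integral_next (n := n + t) fun s => (hF s).mono (Nat.le_add_right n t)
    rw [← add_assoc, h1, ih (F := fun x s => ∑ s', P s s' * F x s')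
      fun s x y hxy => Finset.sum_congr rfl fun s' _ => by
        have := hF s' x y hxy
        simp only at this
        rw [this]]
    congr 1
    funext w
    simp only [pow_succ, Matrix.mul_apply, Finset.mul_sum, Finset.sum_mul]
    rw [Finset.sum_comm]
    exact Finset.sum_congr rfl fun _ _ => Finset.sum_congr rfl fun _ _ => by ring

/-- Conditions on the past of time `n`: the chain runs freely for `t` steps and then makes the
transition at which the past-dependent `F` is evaluated. -/
theorem IsMarkovChain.integral_transition [DecidableEq S] (hX : IsMarkovChain P X μ)
    {n : ℕ} (t : ℕ) {F : (ℕ → S) → S → S → ℝ} (hF : ∀ s s', Past n fun x => F x s s') :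
    ∫ w, F (fun i => X i w) (X (n + t) w) (X (n + t + 1) w) ∂μ
      = ∫ w, ∑ s, (P ^ t) (X n w) s * ∑ s', P s s' * F (fun i => X i w) s s' ∂μ := by
  have h1 := hX.integral_next (n := n + t) (F := fun x s' => F x (x (n + t)) s')
    fun s' x y hxy => by
      simp only [hxy (n + t) le_rfl]
      exact hF _ _ x y fun i hi => hxy i (by omega)
  rw [h1, hX.integral_later t (F := fun x s => ∑ s', P s s' * F x s s')
    fun s x y hxy => Finset.sum_congr rfl fun s' _ => by
      have := hF s s' x y hxy
      simp only at this
      rw [this]]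

end Chain

theorem past_run {S : Type*} [Fintype S] {d : ℕ} (M : Model S d) (γ R β η δ : ℝ)
    (θ₀ : EuclideanSpace ℝ (Fin d)) (n : ℕ) : Past (n + 1) fun x => run M γ R β η δ θ₀ x n := by
  induction n with
  | zero => exact fun _ _ _ => rfl
  | succ n ih =>
    intro x y hxy
    have := ih x y fun i hi => hxy i (by omega)
    simp only at this
    simp only [run, this, hxy (n + 1) (by omega), hxy (n + 2) le_rfl]

/-! ### Choice of the horizon and the delay -/

section Horizon

theorem exists_exp_gt_cubic {c₁ C : ℝ} (hc₁ : 0 < c₁) :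
    ∃ t : ℝ, 0 ≤ t ∧ C * (9 + 2 * t) ^ 3 < c₁ * Real.exp t := by
  have h := (Real.tendsto_pow_mul_exp_neg_atTop_nhds_zero 3).const_mul (|C| * 1331)
  rw [mul_zero] at h
  obtain ⟨t, ht, ht1⟩ := ((h.eventually_lt_const hc₁).and (eventually_ge_atTop 1)).exists
  refine ⟨t, by linarith, ?_⟩
  have h1 : (9 + 2 * t) ^ 3 ≤ (11 * t) ^ 3 :=
    pow_le_pow_left₀ (by linarith) (by linarith) 3
  have h2 : C * (9 + 2 * t) ^ 3 ≤ |C| * (11 * t) ^ 3 :=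
    mul_le_mul (le_abs_self C) h1 (by positivity) (abs_nonneg C)
  have h3 := mul_lt_mul_of_pos_right ht (Real.exp_pos t)
  have h4 : |C| * 1331 * (t ^ 3 * Real.exp (-t)) * Real.exp t = |C| * (11 * t) ^ 3 := by
    have : Real.exp (-t) * Real.exp t = 1 := by rw [← Real.exp_add]; simp
    calc _ = |C| * (11 * t) ^ 3 * (Real.exp (-t) * Real.exp t) := by ring
      _ = _ := by rw [this, mul_one]
  linarith

theorem pow_le_inv_of_log_le {ρ K : ℝ} {τ : ℕ} (hρ₀ : 0 ≤ ρ) (hτ : 1 ≤ τ) (hK : 0 < K)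
    (h : 0 < ρ → Real.log K ≤ τ * Real.log (1 / ρ)) : K * ρ ^ τ ≤ 1 := by
  rcases hρ₀.eq_or_lt with h0 | h0
  · rw [← h0, zero_pow (by omega), mul_zero]
    exact zero_le_one
  · have h1 := h h0
    rw [one_div, Real.log_inv] at h1
    have hp : 0 < K * ρ ^ τ := by positivity
    rw [← Real.log_nonpos_iff hp.le, Real.log_mul hK.ne' (by positivity), Real.log_pow]
    linarith

/-- A horizon `K` and a delay `τ` at which the error bound drops below `ε`. -/
theorem exists_horizon {ν c₁ C : ℝ} (hν₀ : 0 < ν) (hν₁ : ν ≤ 1) (hc₁ : 0 < c₁) (hC : 0 ≤ C) :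
    ∃ C₀ : ℝ, 0 < C₀ ∧ ∀ ρ ε : ℝ, 0 ≤ ρ → ρ < 1 → 0 < ε → ε ≤ 1 / 2 →
      ∃ K τ : ℕ, 1 ≤ K ∧ 1 ≤ τ ∧
        (K : ℝ) ≤ C₀ * (rate ν ρ ε * Real.log (rate ν ρ ε) ^ 6) ∧
        C * (τ ^ 2 * (1 + Real.log K) + K * ρ ^ τ) < c₁ * (ε * (K : ℝ) ^ (1 - ν / 2)) := by
  obtain ⟨t, ht, htC⟩ := exists_exp_gt_cubic (C := 17 * C) hc₁
  have hl2 := Real.log_two_gt_d9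
  have hl2' := Real.log_two_lt_d9
  have hl0 : 0 < Real.log 2 := by linarith
  -- The 2 pays for rounding `K` up; `log 2 ^ 6` comes from normalising `L = log b / log 2` so that
  -- `L ≥ 1`.
  refine ⟨2 * Real.exp (2 * t) / Real.log 2 ^ 6, by positivity, fun ρ ε hρ₀ hρ₁ hε₀ hε₁ => ?_⟩
  set C₁ := Real.exp (2 * t) with hC₁
  have hC₁1 : 1 ≤ C₁ := Real.one_le_exp (by linarith)
  set s := 1 - ν / 2 with hs
  have hs2 : 1 / 2 ≤ s := by linarith
  have hs0 : 0 < s := by linarith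
  have hs1 : s ≤ 1 := by linarith
  set M := max 1 (Real.log (1 / ε) / Real.log (1 / ρ)) with hM
  have hM1 : 1 ≤ M := le_max_left _ _
  have hMε : 2 ≤ M ^ 2 / ε := by
    rw [le_div_iff₀ hε₀]
    linarith [one_le_pow₀ hM1 (n := 2)]
  set b := rate ν ρ ε with hb
  have hbdef : b = (M ^ 2 / ε) ^ (1 / s) := rfl
  have hb2 : 2 ≤ b := by
    have h1 : (2 : ℝ) ^ (1 : ℝ) ≤ 2 ^ (1 / s) :=
      Real.rpow_le_rpow_of_exponent_le (by norm_num) (by rw [le_div_iff₀ hs0]; linarith)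
    rw [Real.rpow_one] at h1
    rw [hbdef]
    exact h1.trans (Real.rpow_le_rpow (by norm_num) hMε (by positivity))
  have hbs : ε * b ^ s = M ^ 2 := by
    rw [hbdef, ← Real.rpow_mul (by positivity), one_div_mul_cancel hs0.ne', Real.rpow_one]
    field_simp
  set L := Real.log b / Real.log 2 with hL
  have hL1 : 1 ≤ L := by
    rw [le_div_iff₀ hl0, one_mul]
    exact Real.log_le_log (by norm_num) hb2
  have hlogb : Real.log b = L * Real.log 2 := by rw [hL, div_mul_cancel₀ _ hl0.ne']
  -- The left side grows like `M² L³`, from `τ²` and one more logarithm. Since `s ≥ 1/2`, the sixth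
  -- power in `Y` supplies `L³` in `Y ^ s`.
  set Y := C₁ * L ^ 6 with hY
  have hY1 : 1 ≤ Y := one_le_mul_of_one_le_of_one_le hC₁1 (one_le_pow₀ hL1)
  have hbY2 : 2 ≤ b * Y := hb2.trans (le_mul_of_one_le_right (by linarith) hY1)
  set K := ⌈b * Y⌉₊ with hK
  have hKge : b * Y ≤ K := Nat.le_ceil _
  have hKle : (K : ℝ) ≤ 2 * (b * Y) := by
    have := Nat.ceil_lt_add_one (by linarith : 0 ≤ b * Y)
    linarith
  have hK2 : (2 : ℝ) ≤ K := hbY2.trans hKge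
  set l := Real.log K with hl
  have hl2K : Real.log 2 ≤ l := Real.log_le_log (by norm_num) hK2
  have hl0' : 0 < l := by linarith
  have hMl : 1 ≤ M * l / Real.log 2 := by
    rw [le_div_iff₀ hl0, one_mul]
    exact hl2K.trans (le_mul_of_one_le_left hl0'.le hM1)
  -- Since `ε ≤ 1/2`, `M * log (1/ρ) ≥ log (1/ε) ≥ log 2` for `ρ > 0`; hence `τ * log (1/ρ) ≥ log K`
  -- and `K * ρ ^ τ ≤ 1`.
  set τ := ⌈M * l / Real.log 2⌉₊ with hτ
  have hτge : M * l / Real.log 2 ≤ τ := Nat.le_ceil _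
  have hτle : (τ : ℝ) ≤ 4 * (M * l) := by
    have h1 := Nat.ceil_lt_add_one (by linarith : 0 ≤ M * l / Real.log 2)
    have h2 : 2 * (M * l / Real.log 2) ≤ 4 * (M * l) := by
      rw [mul_div_assoc', div_le_iff₀ hl0]
      have : 0 ≤ M * l := by positivity
      linarith [mul_le_mul_of_nonneg_left hl2.le this]
    linarith
  have hτ1 : 1 ≤ τ := by exact_mod_cast hMl.trans hτge
  refine ⟨K, τ, by exact_mod_cast (by linarith : (1 : ℝ) ≤ K), hτ1, ?_, ?_⟩
  · refine hKle.trans (le_of_eq ?_)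
    rw [hY, hL]
    field_simp
  · have hKρ : (K : ℝ) * ρ ^ τ ≤ 1 := by
      refine pow_le_inv_of_log_le hρ₀ hτ1 (by linarith) fun hρ => ?_
      have hlρ : 0 < Real.log (1 / ρ) := Real.log_pos ((one_lt_div hρ).2 hρ₁)
      have h1 : Real.log 2 ≤ M * Real.log (1 / ρ) := by
        have h2 : Real.log (1 / ε) / Real.log (1 / ρ) ≤ M := le_max_right _ _
        rw [div_le_iff₀ hlρ] at h2
        refine (Real.log_le_log (by norm_num) ?_).trans h2
        rw [le_div_iff₀ hε₀]
        linarith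
      have h3 : l ≤ M * l / Real.log 2 * Real.log (1 / ρ) := by
        rw [div_mul_eq_mul_div, le_div_iff₀ hl0]
        linarith [mul_le_mul_of_nonneg_left h1 hl0'.le]
      exact h3.trans (mul_le_mul_of_nonneg_right hτge hlρ.le)
    have hτ2 : (τ : ℝ) ^ 2 ≤ 16 * M ^ 2 * l ^ 2 := by
      have := pow_le_pow_left₀ (Nat.cast_nonneg τ) hτle 2
      linarith [(by ring : (4 * (M * l)) ^ 2 = 16 * M ^ 2 * l ^ 2)]
    have hlhs : (τ : ℝ) ^ 2 * (1 + l) + K * ρ ^ τ ≤ 17 * (M ^ 2 * (1 + l) ^ 3) := by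
      have h1 : (τ : ℝ) ^ 2 * (1 + l) ≤ 16 * M ^ 2 * l ^ 2 * (1 + l) :=
        mul_le_mul_of_nonneg_right hτ2 (by linarith)
      have hM2 : 1 ≤ M ^ 2 := one_le_pow₀ hM1
      have h2 : l ^ 2 * (1 + l) ≤ (1 + l) ^ 3 := by linarith [sq_nonneg l]
      have h3 : 1 ≤ (1 + l) ^ 3 := one_le_pow₀ (by linarith)
      have h4 : 1 ≤ M ^ 2 * (1 + l) ^ 3 := one_le_mul_of_one_le_of_one_le hM2 h3
      have h5 := mul_le_mul_of_nonneg_left h2 (by linarith : 0 ≤ M ^ 2)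
      linarith
    -- `K` itself contains `exp (2 * t)`, so its logarithm grows linearly in `t`, whereas the gain
    -- in `Y ^ s` is `exp t`; this is why `t` was taken from `exists_exp_gt_cubic`.
    have hlog : 1 + l ≤ (9 + 2 * t) * L := by
      have h1 : l ≤ Real.log (2 * (b * Y)) := Real.log_le_log (by linarith) hKle
      have hLpos : 0 < L := by linarith
      rw [Real.log_mul (by norm_num) (by positivity), Real.log_mul (by positivity) (by positivity),
        hY, Real.log_mul (by positivity) (by positivity), Real.log_pow, hC₁, Real.log_exp,
        hlogb] at h1
      have h2 := Real.log_le_self hLpos.le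
      push_cast at h1
      linarith [mul_le_mul_of_nonneg_left hL1 ht, mul_le_mul_of_nonneg_left hl2'.le hLpos.le]
    have hlog3 : (1 + l) ^ 3 ≤ (9 + 2 * t) ^ 3 * L ^ 3 := by
      rw [← mul_pow]
      exact pow_le_pow_left₀ (by linarith) hlog 3
    have hYs : Real.exp t * L ^ 3 ≤ Y ^ s := by
      have h1 : Y ^ (1 / 2 : ℝ) ≤ Y ^ s := Real.rpow_le_rpow_of_exponent_le hY1 hs2
      have h2 : Y = (Real.exp t * L ^ 3) ^ 2 := by
        rw [hY, hC₁, mul_pow, ← Real.exp_nat_mul]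
        push_cast
        ring
      rw [← Real.sqrt_eq_rpow, h2, Real.sqrt_sq (by positivity)] at h1
      rwa [h2]
    have hKs : M ^ 2 * (Real.exp t * L ^ 3) ≤ ε * (K : ℝ) ^ s := by
      have h1 : (b * Y) ^ s ≤ (K : ℝ) ^ s := Real.rpow_le_rpow (by linarith) hKge hs0.le
      rw [Real.mul_rpow (by linarith) (by linarith)] at h1
      have h2 := mul_le_mul_of_nonneg_left h1 hε₀.le
      rw [← mul_assoc, hbs] at h2
      exact (mul_le_mul_of_nonneg_left hYs (sq_nonneg M)).trans h2
    have hML : 0 < M ^ 2 * L ^ 3 := by positivity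
    calc C * ((τ : ℝ) ^ 2 * (1 + l) + K * ρ ^ τ) ≤ C * (17 * (M ^ 2 * (1 + l) ^ 3)) :=
          mul_le_mul_of_nonneg_left hlhs hC
      _ ≤ C * (17 * (M ^ 2 * ((9 + 2 * t) ^ 3 * L ^ 3))) := by gcongr
      _ = 17 * C * (9 + 2 * t) ^ 3 * (M ^ 2 * L ^ 3) := by ring
      _ < c₁ * Real.exp t * (M ^ 2 * L ^ 3) := mul_lt_mul_of_pos_right htC hML
      _ = c₁ * (M ^ 2 * (Real.exp t * L ^ 3)) := by ring
      _ ≤ c₁ * (ε * (K : ℝ) ^ s) := mul_le_mul_of_nonneg_left hKs hc₁.le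

end Horizon

theorem neg_integral_le_of_abs_le {Ω : Type*} [MeasurableSpace Ω] {μ : Measure Ω}
    [IsProbabilityMeasure μ] {f : Ω → ℝ} {C : ℝ} (h : ∀ w, |f w| ≤ C) : -∫ w, f w ∂μ ≤ C := by
  have := norm_integral_le_of_norm_le_const (μ := μ) (f := f) (C := C) (ae_of_all _ h)
  rw [probReal_univ, mul_one] at this
  exact (neg_le_abs _).trans this

/-! ### Expected noise and expected accumulated error -/

section Expectation

variable {S : Type*} [Fintype S] [DecidableEq S] [MeasurableSpace S] [MeasurableSingletonClass S]
  {Ω : Type*} [MeasurableSpace Ω] {μ : Measure Ω} [IsProbabilityMeasure μ]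
  {d : ℕ} {M : Model S d} {π : S → ℝ} {X : ℕ → Ω → S} {γ B R κ ρ β η δ : ℝ}
  {θ₀ θs : EuclideanSpace ℝ (Fin d)}

/-- The expectation of the noise in a parameter that lags `τ` steps behind. -/
theorem neg_integral_delayed_noise_le [Nonempty S] (hmix : M.Mixing π κ ρ)
    (hX : IsMarkovChain M.P X μ) (hγ₀ : 0 < γ) (hγ₁ : γ < 1) (hR : 0 < R) (hη : 0 < η)
    (hδ : 0 < δ) (hφ : ∀ s, ‖M.φ s‖ ≤ 1) (hB : ∀ s s', |M.reward s s'| ≤ B)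
    (hθs : ‖θs‖ ≤ R) (hθ₀ : ‖θ₀‖ ≤ R) (τ n : ℕ) :
    -∫ w, (run M γ R β η δ θ₀ (fun i => X i w) n).stepSize η δ
        * M.noise γ π θs (run M γ R β η δ θ₀ (fun i => X i w) n).θ (X (n + τ + 1) w)
          (X (n + τ + 2) w) ∂μ
      ≤ η / Real.sqrt δ * (4 * R * (B + 2 * R)) * (κ * ρ ^ τ) := by
  set F : (ℕ → S) → S → S → ℝ := fun x s s' => (run M γ R β η δ θ₀ x n).stepSize η δ
    * M.noise γ π θs (run M γ R β η δ θ₀ x n).θ s s' with hF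
  have hpast : ∀ s s', Past (n + 1) fun x => F x s s' := fun s s' x y hxy => by
    have := past_run M γ R β η δ θ₀ n x y hxy
    simp only at this
    simp only [hF, this]
  have h1 := hX.integral_transition τ hpast
  -- Memory `n` has already seen state `n + 1`, so exactly `τ` free steps precede the transition
  -- from `n + τ + 1`.
  have e : n + 1 + τ = n + τ + 1 := by omega
  rw [e] at h1
  change -∫ w, F (fun i => X i w) (X (n + τ + 1) w) (X (n + τ + 1 + 1) w) ∂μ ≤ _
  rw [h1]
  refine neg_integral_le_of_abs_le fun w => ?_
  set y := run M γ R β η δ θ₀ (fun i => X i w) n with hy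
  have e1 : ∑ s, (M.P ^ τ) (X (n + 1) w) s * ∑ s', M.P s s' * F (fun i => X i w) s s'
      = y.stepSize η δ
        * ∑ s, (M.P ^ τ) (X (n + 1) w) s * ∑ s', M.P s s' * M.noise γ π θs y.θ s s' := by
    simp only [Finset.mul_sum, hF, ← hy]
    exact Finset.sum_congr rfl fun _ _ => Finset.sum_congr rfl fun _ _ => by ring
  have h2 := hmix.abs_sum_noise_le (γ := γ) (θs := θs) (θ := y.θ)
    (fun s s' => hmix.stationary.abs_noise_le hγ₀ hγ₁ hφ hB hθs
      (norm_run_θ_le (fun i => X i w) hR.le hθ₀ n) s s') τ (X (n + 1) w)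
  have h3 : y.stepSize η δ ≤ η / Real.sqrt δ := by
    have := antitone_stepSize_run (M := M) (γ := γ) (R := R) (β := β) (θ₀ := θ₀)
      (fun i => X i w) hη hδ (Nat.zero_le n)
    simp only [stepSize_run_zero] at this
    exact this
  have h4 : 0 ≤ y.stepSize η δ := stepSize_run_nonneg _ hη n
  show |∑ s, (M.P ^ τ) (X (n + 1) w) s * ∑ s', M.P s s' * F (fun i => X i w) s s'| ≤ _
  rw [e1, abs_mul, abs_of_nonneg h4, mul_assoc]
  exact mul_le_mul h3 h2 (abs_nonneg _) (h4.trans h3)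

/-- The expected error, weighted by the step sizes, that is accumulated up to time `K`. -/
theorem sum_integral_error_le [Nonempty S] {c₀ : ℝ} (hmix : M.Mixing π κ ρ) (hρ₀ : 0 ≤ ρ)
    (hX : IsMarkovChain M.P X μ) (hγ₀ : 0 < γ) (hγ₁ : γ < 1) (hR : 0 < R) (hB₀ : 0 ≤ B)
    (hβ₀ : 0 ≤ β) (hβ₁ : β < 1) (hη : 0 < η)
    (hδ : 0 < δ) (hφ : ∀ s, ‖M.φ s‖ ≤ 1) (hB : ∀ s s', |M.reward s s'| ≤ B)
    (hs : M.SolvesProjectedBellman γ π θs)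
    (hθs : ‖θs‖ ≤ R) (hθ₀ : ‖θ₀‖ ≤ R) (hc₀ : 0 < c₀)
    (hdrift : ∀ θ, c₀ * ‖θ - θs‖ ^ 2 ≤ inner ℝ (θs - θ) (M.meanGrad γ π θ))
    {τ : ℕ} (hτ : 1 ≤ τ) (K : ℕ) :
    c₀ / 2 * ∑ n ∈ Finset.range K,
        ∫ w, (run M γ R β η δ θ₀ (fun i => X i w) (n + 1)).stepSize η δ
          * ‖(run M γ R β η δ θ₀ (fun i => X i w) n).θ - θs‖ ^ 2 ∂μ
      ≤ (2 * R ^ 2 + 2 * R * (B + 2 * R) * (η / Real.sqrt δ) / (1 - β))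
        + (1 / (1 - β) + 18 * (η / Real.sqrt δ) / c₀ + 4 * (η / Real.sqrt δ) + 1) * τ ^ 2
          * (η ^ 2 * Real.log (1 + K * (B + 2 * R) ^ 2 / δ))
        + 4 * R * (B + 2 * R) * (η / Real.sqrt δ) * (2 * τ + 1 + K * (κ * ρ ^ τ)) := by
  set Q : ℕ → (ℕ → S) → ℝ := fun n x => (run M γ R β η δ θ₀ x (n + 1)).stepSize η δ
    * ‖(run M γ R β η δ θ₀ x n).θ - θs‖ ^ 2 with hQ
  set N : ℕ → (ℕ → S) → ℝ := fun n x => (run M γ R β η δ θ₀ x (n - τ)).stepSize η δ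
    * M.noise γ π θs (run M γ R β η δ θ₀ x (n - τ)).θ (x (n + 1)) (x (n + 2)) with hN
  have hrun : ∀ m n, m + 1 ≤ n → ∀ x y : ℕ → S, (∀ i ≤ n, x i = y i) →
      run M γ R β η δ θ₀ x m = run M γ R β η δ θ₀ y m := fun m n hmn x y hxy =>
    past_run M γ R β η δ θ₀ m x y fun i hi => hxy i (hi.trans hmn)
  have hQi : ∀ n, Integrable (fun w => Q n fun i => X i w) μ := fun n =>
    Past.integrable hX.measurable (n := n + 2) fun x y hxy => by
      simp only [hQ, hrun (n + 1) (n + 2) le_rfl x y hxy, hrun n (n + 2) (by omega) x y hxy]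
  have hNi : ∀ n, Integrable (fun w => N n fun i => X i w) μ := fun n =>
    Past.integrable hX.measurable (n := n + 2) fun x y hxy => by
      simp only [hN, hrun (n - τ) (n + 2) (by omega) x y hxy, hxy (n + 1) (by omega),
        hxy (n + 2) le_rfl]
  set a₀ := η / Real.sqrt δ with ha₀
  set H := 4 * R * (B + 2 * R) with hH
  set A := (2 * R ^ 2 + 2 * R * (B + 2 * R) * a₀ / (1 - β))
        + (1 / (1 - β) + 18 * a₀ / c₀ + 4 * a₀ + 1) * τ ^ 2
          * (η ^ 2 * Real.log (1 + K * (B + 2 * R) ^ 2 / δ)) + H * a₀ * (τ + 1) with hA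
  have hH0 : 0 ≤ H := by positivity
  have ha0 : 0 ≤ a₀ := by positivity
  have hpath : ∀ w, c₀ / 2 * ∑ n ∈ Finset.range K, Q n (fun i => X i w)
      + ∑ n ∈ Finset.range K, N n (fun i => X i w) ≤ A := fun w =>
    sum_error_add_noise_le (fun i => X i w) hmix.stationary hγ₀ hγ₁ hR hB₀ hβ₀ hβ₁ hη hδ hφ hB hs
      hθs hθ₀ hc₀ hdrift hτ K
  have hQs : Integrable (fun w => c₀ / 2 * ∑ n ∈ Finset.range K, Q n fun i => X i w) μ :=
    (integrable_finsetSum _ fun n _ => hQi n).const_mul _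
  have hNs : Integrable (fun w => ∑ n ∈ Finset.range K, N n fun i => X i w) μ :=
    integrable_finsetSum _ fun n _ => hNi n
  have hint := integral_mono (hQs.add hNs) (integrable_const A) hpath
  simp only [Pi.add_apply] at hint
  rw [integral_add hQs hNs, integral_const_mul, integral_finsetSum _ fun n _ => hQi n,
    integral_finsetSum _ fun n _ => hNi n, integral_const, probReal_univ, one_smul] at hint
  have hκ : 0 ≤ κ * ρ ^ τ := mul_nonneg hmix.const_nonneg (pow_nonneg hρ₀ _)
  -- The first `τ` terms have no full delay and are bounded trivially; together with the `τ + 1`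
  -- from the weights they give `2 * τ + 1`.
  have hterm : ∀ n, -∫ w, N n (fun i => X i w) ∂μ
      ≤ (if n < τ then a₀ * H else 0) + a₀ * H * (κ * ρ ^ τ) := by
    intro n
    split_ifs with hn
    · refine le_add_of_le_of_nonneg ?_ (by positivity)
      refine neg_integral_le_of_abs_le fun w => ?_
      have h1 := hmix.stationary.abs_noise_le hγ₀ hγ₁ hφ hB hθs
        (norm_run_θ_le (M := M) (γ := γ) (β := β) (η := η) (δ := δ) (fun i => X i w) hR.le hθ₀
          (n - τ)) (X (n + 1) w) (X (n + 2) w)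
      have h2 := antitone_stepSize_run (M := M) (γ := γ) (R := R) (β := β) (θ₀ := θ₀)
        (fun i => X i w) hη hδ (Nat.zero_le (n - τ))
      have h3 := stepSize_run_nonneg (M := M) (γ := γ) (R := R) (β := β) (θ₀ := θ₀) (δ := δ)
        (fun i => X i w) hη (n - τ)
      simp only [stepSize_run_zero] at h2
      show |_ * _| ≤ _
      rw [abs_mul, abs_of_nonneg h3]
      exact mul_le_mul h2 h1 (abs_nonneg _) ha0
    · obtain ⟨j, rfl⟩ := Nat.exists_eq_add_of_le' (not_lt.1 hn)
      have := neg_integral_delayed_noise_le (β := β) hmix hX hγ₀ hγ₁ hR hη hδ hφ hB hθs hθ₀ τ j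
      simp only [hN, Nat.add_sub_cancel, zero_add]
      exact this
  have hsum := Finset.sum_le_sum fun n (_ : n ∈ Finset.range K) => hterm n
  rw [Finset.sum_neg_distrib, Finset.sum_add_distrib, Finset.sum_const, Finset.card_range,
    nsmul_eq_mul, ← Finset.sum_filter, Finset.sum_const, nsmul_eq_mul] at hsum
  have hcard : (((Finset.range K).filter fun n => n < τ).card : ℝ) ≤ τ := by
    have : (Finset.range K).filter (fun n => n < τ) ⊆ Finset.range τ := fun n => by
      simp only [Finset.mem_filter, Finset.mem_range]
      exact fun h => h.2
    have := Finset.card_le_card this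
    rw [Finset.card_range] at this
    exact_mod_cast this
  have hcard' := mul_le_mul_of_nonneg_right hcard (mul_nonneg ha0 hH0)
  linarith

end Expectation

theorem log_one_add_mul_le {x : ℝ} (hx : 0 ≤ x) {K : ℕ} (hK : 1 ≤ K) :
    Real.log (1 + K * x) ≤ Real.log (1 + x) + Real.log K := by
  have h1 : (1 : ℝ) ≤ K := by exact_mod_cast hK
  rw [← Real.log_mul (by positivity) (by positivity)]
  exact Real.log_le_log (by positivity) (by nlinarith)

/-- `K ^ ν ≥ 1` absorbs `δ` into the factor `c + δ`, giving one lower bound for all step sizes up to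
`K`. -/
theorem div_sqrt_mul_rpow_le {η δ c ν v : ℝ} {n K : ℕ} (hη : 0 < η) (hδ : 0 < δ) (hc : 0 < c)
    (hν : 0 < ν) (hv₀ : 0 ≤ v) (hn : 1 ≤ n) (hnK : n ≤ K) (hv : v ≤ c * (n : ℝ) ^ ν) :
    η / Real.sqrt (c + δ) * (K : ℝ) ^ (-(ν / 2)) ≤ η / Real.sqrt (v + δ) := by
  have hK1 : (1 : ℝ) ≤ K := by exact_mod_cast hn.trans hnK
  have h1 : (n : ℝ) ^ ν ≤ (K : ℝ) ^ ν :=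
    Real.rpow_le_rpow (Nat.cast_nonneg n) (by exact_mod_cast hnK) hν.le
  have h2 : (1 : ℝ) ≤ (K : ℝ) ^ ν := Real.one_le_rpow hK1 hν.le
  have h3 : v + δ ≤ (c + δ) * (K : ℝ) ^ ν := by nlinarith
  have h4 : Real.sqrt ((K : ℝ) ^ ν) = (K : ℝ) ^ (ν / 2) := by
    rw [Real.sqrt_eq_rpow, ← Real.rpow_mul (by linarith)]
    congr 1
    ring
  rw [Real.rpow_neg (by linarith), ← h4, ← div_eq_mul_inv, div_div,
    ← Real.sqrt_mul (by linarith)]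
  exact div_le_div_of_nonneg_left hη.le (Real.sqrt_pos.2 (by linarith)) (Real.sqrt_le_sqrt h3)

end AdaTD

/-! ### The complexity bound -/

theorem theorem2
    -- the parameters on which the hidden constants may depend
    (γ B R ω κ β η δ c ν : ℝ)
    (hγ₀ : 0 < γ) (hγ₁ : γ < 1) (hR₀ : 0 < R)
    (hR : 2 * B / (Real.sqrt ω * (1 - γ) ^ (3 / 2 : ℝ)) ≤ R)
    (hβ₀ : 0 ≤ β) (hβ₁ : β < 1) (hη : 0 < η) (hδ : 0 < δ)
    (hc : 0 < c) (hν₀ : 0 < ν) (hν₁ : ν ≤ 1) :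
    ∃ (C : ℝ) (p : ℕ), 0 < C ∧
      ∀ (S : Type*) [Fintype S] [DecidableEq S] [MeasurableSpace S] [MeasurableSingletonClass S]
        (Ω : Type*) [MeasurableSpace Ω] (μ : MeasureTheory.Measure Ω)
        [MeasureTheory.IsProbabilityMeasure μ]
        (d : ℕ) (M : AdaTD.Model S d) (π : S → ℝ) (ρ : ℝ) (X : ℕ → Ω → S)
        (θ₀ θs : EuclideanSpace ℝ (Fin d)),
        (∀ s s', |M.reward s s'| ≤ B) →
        0 ≤ ρ → ρ < 1 → M.Mixing π κ ρ →
        (∀ s, ‖M.φ s‖ ≤ 1) → M.featureMatrix.rank = d →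
        M.IsMinEigenvalue π ω →
        M.SolvesProjectedBellman γ π θs →
        AdaTD.IsMarkovChain M.P X μ →
        ‖θ₀‖ ≤ R →
        (∀ᵐ w ∂μ, ∀ k : ℕ, 1 ≤ k →
          AdaTD.accum M γ R β η δ θ₀ (fun i => X i w) k ≤ c * (k : ℝ) ^ ν) →
        ∀ ε : ℝ, 0 < ε → ε ≤ 1 / 2 →
          ∃ K : ℕ, 1 ≤ K ∧
            (K : ℝ) ≤ C * (AdaTD.rate ν ρ ε * Real.log (AdaTD.rate ν ρ ε) ^ p) ∧
            -- the minimum over 1 ≤ k ≤ K of the mean squared error is at most ε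
            ∃ k ∈ Finset.Icc 1 K,
              ∫ w, ‖AdaTD.iterate M γ R β η δ θ₀ (fun i => X i w) k - θs‖ ^ 2 ∂μ ≤ ε := by
  -- The constants are fixed before the model. If these signs fail, no model satisfies the
  -- assumptions and any constants serve.
  by_cases hpar : 0 ≤ B ∧ 0 < ω ∧ 0 ≤ κ
  swap
  · refine ⟨1, 0, one_pos, ?_⟩
    intro S _ _ _ _ Ω _ μ _ d M π ρ X θ₀ θs hB _ _ hmix _ hrank hmin _ _ _ _
    obtain ⟨w⟩ := nonempty_of_isProbabilityMeasure μ
    have : Nonempty S := ⟨X 0 w⟩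
    exact absurd ⟨(abs_nonneg _).trans (hB (X 0 w) (X 0 w)), hmin.pos hmix.pos hrank,
      hmix.const_nonneg⟩ hpar
  obtain ⟨hB₀, hω, hκ⟩ := hpar
  set c₀ := (1 - γ) * ω with hc₀
  have hc₀p : 0 < c₀ := mul_pos (by linarith) hω
  set a₀ := η / Real.sqrt δ with ha₀
  have ha₀p : 0 < a₀ := div_pos hη (Real.sqrt_pos.2 hδ)
  set G := B + 2 * R with hG
  have hGp : 0 < G := by positivity
  have hβp : 0 < 1 - β := by linarith
  set A₁ := 2 * R ^ 2 + 2 * R * G * a₀ / (1 - β) with hA₁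
  set W := 1 / (1 - β) + 18 * a₀ / c₀ + 4 * a₀ + 1 with hW
  set D := Real.log (1 + G ^ 2 / δ) with hD
  set H := 4 * R * G * a₀ with hH
  have hA₁p : 0 ≤ A₁ := by positivity
  have hWp : 0 ≤ W := by positivity
  have hHp : 0 ≤ H := by positivity
  have hDp : 0 ≤ D := Real.log_nonneg (by
    have : 0 ≤ G ^ 2 / δ := by positivity
    linarith)
  have hα : 0 < η / Real.sqrt (c + δ) := div_pos hη (Real.sqrt_pos.2 (by linarith))
  obtain ⟨C₀, hC₀, hor⟩ := AdaTD.exists_horizon hν₀ hν₁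
    (c₁ := c₀ / 2 * (η / Real.sqrt (c + δ))) (C := A₁ + W * η ^ 2 * (1 + D) + H * (3 + κ))
    (by positivity) (by positivity)
  refine ⟨C₀, 6, hC₀, ?_⟩
  intro S _ _ _ _ Ω _ μ _ d M π ρ X θ₀ θs hB hρ₀ hρ₁ hmix hφ hrank hmin hs hX hθ₀ hv ε hε₀ hε₁
  obtain ⟨w₀⟩ := nonempty_of_isProbabilityMeasure μ
  have : Nonempty S := ⟨X 0 w₀⟩
  obtain ⟨K, τ, hK, hτ, hKle, hlt⟩ := hor ρ ε hρ₀ hρ₁ hε₀ hε₁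
  refine ⟨K, hK, hKle, ?_⟩
  by_contra! hcon
  have hπ := hmix.stationary
  have hθs : ‖θs‖ ≤ R := hπ.norm_solution_le hmin hω hγ₀ hγ₁ hB hB₀ hR hs
  have hdrift : ∀ θ, c₀ * ‖θ - θs‖ ^ 2 ≤ inner ℝ (θs - θ) (M.meanGrad γ π θ) := fun θ => by
    refine le_trans ?_ (hπ.inner_meanGrad_ge hγ₀ hs θ)
    rw [hc₀, mul_assoc]
    exact mul_le_mul_of_nonneg_left (hmin.mul_norm_sq_le _) (by linarith)
  have hup := AdaTD.sum_integral_error_le hmix hρ₀ hX hγ₀ hγ₁ hR₀ hB₀ hβ₀ hβ₁ hη hδ hφ hB hs hθs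
    hθ₀ hc₀p hdrift hτ K
  rw [← hG, ← ha₀, ← hA₁, ← hW, ← hH] at hup
  set α := η / Real.sqrt (c + δ) * (K : ℝ) ^ (-(ν / 2)) with hαdef
  have hlow : ∀ n ∈ Finset.range K, α * ε
      ≤ ∫ w, (AdaTD.run M γ R β η δ θ₀ (fun i => X i w) (n + 1)).stepSize η δ
          * ‖(AdaTD.run M γ R β η δ θ₀ (fun i => X i w) n).θ - θs‖ ^ 2 ∂μ := by
    intro n hn
    have hnK : n + 1 ≤ K := Finset.mem_range.1 hn
    -- `iterate` at `n + 1` is the parameter of `run` at `n`, while the step size taken from it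
    -- belongs to memory `n + 1`.
    have h1 := hcon (n + 1) (Finset.mem_Icc.2 ⟨by omega, hnK⟩)
    have hα0 : 0 ≤ α := mul_nonneg hα.le (Real.rpow_nonneg (Nat.cast_nonneg K) _)
    refine (mul_le_mul_of_nonneg_left h1.le hα0).trans ?_
    rw [← integral_const_mul]
    refine integral_mono_ae ?_ ?_ ?_
    · refine Integrable.const_mul ?_ _
      exact AdaTD.Past.integrable hX.measurable (n := n + 1)
        (F := fun x => ‖(AdaTD.run M γ R β η δ θ₀ x n).θ - θs‖ ^ 2) fun x y hxy => by
          have := AdaTD.past_run M γ R β η δ θ₀ n x y hxy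
          simp only at this
          simp only [this]
    · exact AdaTD.Past.integrable hX.measurable (n := n + 2)
        (F := fun x => (AdaTD.run M γ R β η δ θ₀ x (n + 1)).stepSize η δ
          * ‖(AdaTD.run M γ R β η δ θ₀ x n).θ - θs‖ ^ 2) fun x y hxy => by
          have h2 := AdaTD.past_run M γ R β η δ θ₀ n x y fun i hi => hxy i (by omega)
          have h3 := AdaTD.past_run M γ R β η δ θ₀ (n + 1) x y hxy
          simp only at h2 h3
          simp only [h2, h3]
    · filter_upwards [hv] with w hw
      refine mul_le_mul_of_nonneg_right ?_ (sq_nonneg _)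
      exact AdaTD.div_sqrt_mul_rpow_le hη hδ hc hν₀
        (AdaTD.run_v_nonneg M γ R β η δ θ₀ _ (n + 1)) (by omega) hnK (hw (n + 1) (by omega))
  have hsum := Finset.sum_le_sum hlow
  rw [Finset.sum_const, Finset.card_range, nsmul_eq_mul] at hsum
  have hK1 : (1 : ℝ) ≤ K := by exact_mod_cast hK
  have hKpow : (K : ℝ) * (K : ℝ) ^ (-(ν / 2)) = (K : ℝ) ^ (1 - ν / 2) := by
    rw [sub_eq_add_neg, Real.rpow_add (by linarith), Real.rpow_one]
  have hlhs : c₀ / 2 * (η / Real.sqrt (c + δ)) * (ε * (K : ℝ) ^ (1 - ν / 2))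
      = c₀ / 2 * (K * (α * ε)) := by
    rw [hαdef, ← hKpow]
    ring
  have hl0 : 0 ≤ Real.log K := Real.log_nonneg hK1
  set l := Real.log K with hl
  have hτ1 : (1 : ℝ) ≤ τ := by exact_mod_cast hτ
  have hτ2 : (τ : ℝ) ≤ τ ^ 2 := le_self_pow₀ hτ1 two_ne_zero
  -- `T` dominates `1`, `τ` and `τ²`, so every term of the upper bound is a constant times `T` or
  -- `E`.
  set T := (τ : ℝ) ^ 2 * (1 + l) with hT
  have hτT : (τ : ℝ) ^ 2 ≤ T := le_mul_of_one_le_right (sq_nonneg _) (by linarith)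
  set E := (K : ℝ) * ρ ^ τ with hE
  have hE0 : 0 ≤ E := by positivity
  have hlog : (τ : ℝ) ^ 2 * (η ^ 2 * Real.log (1 + K * G ^ 2 / δ)) ≤ η ^ 2 * (1 + D) * T := by
    have h1 := AdaTD.log_one_add_mul_le (x := G ^ 2 / δ) (by positivity) hK
    rw [← mul_div_assoc, ← hD, ← hl] at h1
    have h2 : Real.log (1 + K * G ^ 2 / δ) ≤ (1 + D) * (1 + l) := by
      linarith [mul_nonneg hDp hl0]
    have h3 := mul_le_mul_of_nonneg_left h2 (by positivity : 0 ≤ (τ : ℝ) ^ 2 * η ^ 2)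
    rw [hT]
    linarith
  have hup' : c₀ / 2 * (K * (α * ε))
      ≤ A₁ * T + W * (η ^ 2 * (1 + D) * T) + H * (3 * T + κ * E) := by
    refine (mul_le_mul_of_nonneg_left hsum (by positivity)).trans (hup.trans ?_)
    have h1 : A₁ ≤ A₁ * T := le_mul_of_one_le_right hA₁p (by linarith)
    have h2 := mul_le_mul_of_nonneg_left hlog hWp
    have h3 : 2 * (τ : ℝ) + 1 + K * (κ * ρ ^ τ) ≤ 3 * T + κ * E := by
      have : (K : ℝ) * (κ * ρ ^ τ) = κ * E := by
        rw [hE]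
        ring
      linarith
    have h4 := mul_le_mul_of_nonneg_left h3 hHp
    rw [mul_assoc W]
    linarith
  have hTE : A₁ * T + W * (η ^ 2 * (1 + D) * T) + H * (3 * T + κ * E)
      ≤ (A₁ + W * η ^ 2 * (1 + D) + H * (3 + κ)) * (T + E) := by
    have hT0 : 0 ≤ T := by linarith
    have h1 : 0 ≤ A₁ * E := mul_nonneg hA₁p hE0
    have h2 : 0 ≤ W * η ^ 2 * (1 + D) * E := by positivity
    have h3 : 0 ≤ H * (3 * E + κ * T) := by positivity
    linarith
  rw [hlhs] at hlt
  linarith
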